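/- Let $\mathcal{N}$ be a simplicial model category whose cofibrations are exactly the monomorphisms: $\mathcal{N}$ is complete, cocomplete, enriched, tensored and cotensored over simplicial sets, and has a model structure such that the Leibniz cotensor of a cofibration $\ell$ of simplicial sets and a fibration $r$ of $\mathcal{N}$ is a fibration, which is a weak equivalence if $\ell$ or $r$ is. Let $\mathcal{M}$ be a simplicially enriched category that is complete and cotensored over simplicial sets, and let $U\colon\mathcal{M}\to\mathcal{N}$ be a simplicial functor with simplicial adjoints $L\dashv U\dashv R$. Suppose that the unit $\eta\colon \mathrm{id}_{\mathcal{N}}\Rightarrow UL$ of the adjunction $L\dashv U$ is a Quillen cofibration: for every cofibration (respectively trivial cofibration) $i\colon A\to B$ in $\mathcal{N}$, the induced map $B\sqcup_A ULA\to ULB$ is a cofibration (respectively trivial cofibration). A map of $\mathcal{M}$ is called a $U$-fibration, respectively a $U$-trivial cofibration, if its image under $U$ is a fibration, respectively a trivial cofibration, in $\mathcal{N}$. It is called an injective fibration if it has the right lifting property with respect to all $U$-trivial cofibrations. For $X\in\mathcal{M}$, let $$C(R,UR,UX)=\int_{[n]\in\Delta}\bigl((RU)^{n+1}X\bigr)^{\Delta^n}$$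 be the cobar construction, the totalization of the cosimplicial object $[n]\mapsto (RU)^{n+1}X=R(UR)^nUX$ defined by the monad $RU$ on $\mathcal{M}$, and let $\nu_X\colon X\to C(R,UR,UX)$ be its natural coaugmentation. For $f\colon X\to Y$ in $\mathcal{M}$, let $Ef$ be the pullback of $C(R,UR,Uf)\colon C(R,UR,UX)\to C(R,UR,UY)$ along $\nu_Y$, let $\rho_f\colon Ef\to Y$ be the projection, and let $\lambda_f\colon X\to Ef$ be the map induced by $\nu_X$ and $f$, so that $f=\rho_f\lambda_f$ (the cobar factorization). Then a map $f\colon X\to Y$ in $\mathcal{M}$ is an injective fibration if and only if $f$ is a $U$-fibration and $\lambda_f$ has a retraction over $Y$, i.e. there is $r\colon Ef\to X$ with $r\lambda_f=\mathrm{id}_X$ and $fr=\rho_f$. In particular, an object $X$ of $\mathcal{M}$ is injectively fibrant ($X\to 1$ is an injective fibration) if and only if it is $U$-fibrant ($X\to 1$ is a $U$-fibration) and $\nu_X\colon X\to C(R,UR,UX)$ has a retraction. -/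

import Mathlib

open CategoryTheory Limits MonoidalCategory Opposite HomotopicalAlgebra

universe v u u₁ u₂

noncomputable section

namespace InjFib

/-! ## Simplicial functors and simplicial adjunctions -/

section Enriched

variable {C : Type u₁} [Category.{v} C] [SimplicialCategory C]
variable {D : Type u₂} [Category.{v} D] [SimplicialCategory D]

/-- The ordinary functor between the underlying categories of a simplicial functor: on morphisms
it is the action on vertices of the simplicial hom-sets. -/
def underlying (F : EnrichedFunctor SSet.{v} C D) : C ⥤ D where
  obj X := F.obj X
  map {X Y} f := (eHomEquiv SSet.{v}).symm (eHomEquiv SSet.{v} f ≫ F.map X Y)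
  map_id X := by
    apply (eHomEquiv SSet.{v}).injective
    simp
  map_comp {X Y Z} f g := by
    apply (eHomEquiv SSet.{v}).injective
    rw [Equiv.apply_symm_apply, eHomEquiv_comp, eHomEquiv_comp, Equiv.apply_symm_apply,
      Equiv.apply_symm_apply, Category.assoc, Category.assoc, F.map_comp,
      MonoidalCategory.tensorHom_comp_tensorHom_assoc]

/-- A simplicial adjunction `F ⊣ G` between simplicial functors: an adjunction between the
underlying functors whose unit and counit are simplicial natural transformations, i.e. natural
with respect to all simplices of the simplicial hom-sets. -/
structure SimplicialAdjunction (F : EnrichedFunctor SSet.{v} C D)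
    (G : EnrichedFunctor SSet.{v} D C) where
  /-- the underlying adjunction -/
  adj : underlying F ⊣ underlying G
  unit_naturality (X Y : C) :
    eHomWhiskerLeft SSet.{v} X (adj.unit.app Y) =
      F.map X Y ≫ G.map (F.obj X) (F.obj Y) ≫
        eHomWhiskerRight SSet.{v} (adj.unit.app X) (G.obj (F.obj Y))
  counit_naturality (X Y : D) :
    eHomWhiskerRight SSet.{v} (adj.counit.app X) Y =
      G.map X Y ≫ F.map (G.obj X) (G.obj Y) ≫
        eHomWhiskerLeft SSet.{v} (F.obj (G.obj X)) (adj.counit.app Y)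

end Enriched

/-! ## Simplicial tensors and cotensors -/

section Cotensors

variable {C : Type u} [Category.{v} C] [SimplicialCategory C]

/-- A tensor `K ⊗ X` of an object `X` of a simplicial category by a simplicial set `K`:
an object representing `A ↦ Map(K, Map(X, A))`. The universal property is tested on maps out of
an arbitrary simplicial set `L`, which amounts to an isomorphism
`Map(K ⊗ X, A) ≅ Map(K, Map(X, A))` of simplicial sets. -/
structure Tensor (K : SSet.{v}) (X : C) where
  /-- the tensor `K ⊗ X` -/
  obj : C
  /-- the universal map -/
  coev : K ⟶ (X ⟶[SSet.{v}] obj)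
  bijective (A : C) (L : SSet.{v}) : Function.Bijective
    (fun g : L ⟶ (obj ⟶[SSet.{v}] A) => (coev ⊗ₘ g) ≫ eComp SSet.{v} X obj A)

/-- A cotensor `X ^ K` of an object `X` of a simplicial category by a simplicial set `K`:
an object representing `A ↦ Map(K, Map(A, X))`. The universal property is tested on maps out of
an arbitrary simplicial set `L`, which amounts to an isomorphism
`Map(A, X ^ K) ≅ Map(K, Map(A, X))` of simplicial sets. -/
structure Cotensor (K : SSet.{v}) (X : C) where
  /-- the cotensor `X ^ K` -/
  obj : C
  /-- the universal map -/
  ev : K ⟶ (obj ⟶[SSet.{v}] X)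
  bijective (A : C) (L : SSet.{v}) : Function.Bijective
    (fun g : L ⟶ (A ⟶[SSet.{v}] obj) => (g ⊗ₘ ev) ≫ eComp SSet.{v} A obj X)

variable (C) in
/-- All tensors by simplicial sets exist. -/
class HasTensors : Prop where
  nonempty_tensor (K : SSet.{v}) (X : C) : Nonempty (Tensor K X)

variable (C) in
/-- All cotensors by simplicial sets exist. -/
class HasCotensors : Prop where
  nonempty_cotensor (K : SSet.{v}) (X : C) : Nonempty (Cotensor K X)

lemma Cotensor.bijective_hom {K : SSet.{v}} {X : C} (c : Cotensor K X) (A : C) :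
    Function.Bijective
      (fun f : A ⟶ c.obj => c.ev ≫ eHomWhiskerRight SSet.{v} f X) := by
  have h := ((c.bijective A (𝟙_ SSet.{v})).comp
    (eHomEquiv SSet.{v} (X := A) (Y := c.obj)).bijective)
  have h' : Function.Bijective (fun g : 𝟙_ SSet.{v} ⊗ K ⟶ (A ⟶[SSet.{v}] X) => (λ_ K).inv ≫ g) :=
    ⟨fun g g' hg => by simpa using hg, fun g => ⟨(λ_ K).hom ≫ g, by simp⟩⟩
  convert h'.comp h using 1
  funext f
  change c.ev ≫ (λ_ _).inv ≫ eHomEquiv SSet.{v} f ▷ _ ≫ eComp SSet.{v} A c.obj X =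
    (λ_ K).inv ≫ (eHomEquiv SSet.{v} f ⊗ₘ c.ev) ≫ eComp SSet.{v} A c.obj X
  rw [MonoidalCategory.tensorHom_def', leftUnitor_inv_naturality_assoc, Category.assoc]

lemma eHomEquiv_whiskerLeft {X Y Z : C} (a : X ⟶ Y) (f : Y ⟶ Z) :
    eHomEquiv SSet.{v} a ≫ eHomWhiskerLeft SSet.{v} X f = eHomEquiv SSet.{v} (a ≫ f) := by
  rw [eHomEquiv_comp, eHomWhiskerLeft, rightUnitor_inv_naturality_assoc,
    MonoidalCategory.tensorHom_def_assoc, unitors_inv_equal]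

lemma eHomEquiv_whiskerRight {X Y Z : C} (a : X ⟶ Y) (f : Y ⟶ Z) :
    eHomEquiv SSet.{v} f ≫ eHomWhiskerRight SSet.{v} a Z = eHomEquiv SSet.{v} (a ≫ f) := by
  rw [eHomEquiv_comp, eHomWhiskerRight, leftUnitor_inv_naturality_assoc,
    MonoidalCategory.tensorHom_def'_assoc]

variable [HasCotensors C]

/-- The chosen cotensor. -/
def theCotensor (K : SSet.{v}) (X : C) : Cotensor K X :=
  (HasCotensors.nonempty_cotensor K X).some

/-- The object `X ^ K`. -/
def cotensor (K : SSet.{v}) (X : C) : C := (theCotensor K X).obj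

/-- The universal map `K ⟶ Map(X ^ K, X)`. -/
def cotensorEv (K : SSet.{v}) (X : C) : K ⟶ (cotensor K X ⟶[SSet.{v}] X) := (theCotensor K X).ev

/-- Maps `A ⟶ X ^ K` correspond to maps `K ⟶ Map(A, X)`. -/
def cotensorHomEquiv (A : C) (K : SSet.{v}) (X : C) :
    (A ⟶ cotensor K X) ≃ (K ⟶ (A ⟶[SSet.{v}] X)) :=
  Equiv.ofBijective (fun f => cotensorEv K X ≫ eHomWhiskerRight SSet.{v} f X)
    ((theCotensor K X).bijective_hom A)

/-- The map `A ⟶ X ^ K` induced by `K ⟶ Map(A, X)`. -/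
def cotensorLift {A : C} {K : SSet.{v}} {X : C} (g : K ⟶ (A ⟶[SSet.{v}] X)) : A ⟶ cotensor K X :=
  (cotensorHomEquiv A K X).symm g

@[simp]
lemma cotensorLift_fac {A : C} {K : SSet.{v}} {X : C} (g : K ⟶ (A ⟶[SSet.{v}] X)) :
    cotensorEv K X ≫ eHomWhiskerRight SSet.{v} (cotensorLift g) X = g :=
  (cotensorHomEquiv A K X).apply_symm_apply g

lemma cotensorLift_fac_assoc {A : C} {K : SSet.{v}} {X : C} (g : K ⟶ (A ⟶[SSet.{v}] X))
    {Z : SSet.{v}} (h : (A ⟶[SSet.{v}] X) ⟶ Z) :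
    cotensorEv K X ≫ eHomWhiskerRight SSet.{v} (cotensorLift g) X ≫ h = g ≫ h := by
  rw [← Category.assoc, cotensorLift_fac]

lemma cotensor_hom_ext {A : C} {K : SSet.{v}} {X : C} {f g : A ⟶ cotensor K X}
    (h : cotensorEv K X ≫ eHomWhiskerRight SSet.{v} f X =
      cotensorEv K X ≫ eHomWhiskerRight SSet.{v} g X) : f = g :=
  (cotensorHomEquiv A K X).injective h

/-- The map `X ^ K ⟶ X' ^ K'` induced by `K' ⟶ K` and `X ⟶ X'`. -/
def cotensorMap {K K' : SSet.{v}} {X X' : C} (k : K' ⟶ K) (f : X ⟶ X') :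
    cotensor K X ⟶ cotensor K' X' :=
  cotensorLift (k ≫ cotensorEv K X ≫ eHomWhiskerLeft SSet.{v} _ f)

@[simp]
lemma cotensorMap_fac {K K' : SSet.{v}} {X X' : C} (k : K' ⟶ K) (f : X ⟶ X') :
    cotensorEv K' X' ≫ eHomWhiskerRight SSet.{v} (cotensorMap k f) X' =
      k ≫ cotensorEv K X ≫ eHomWhiskerLeft SSet.{v} _ f :=
  cotensorLift_fac _

lemma cotensorMap_fac_assoc {K K' : SSet.{v}} {X X' : C} (k : K' ⟶ K) (f : X ⟶ X')
    {Z : SSet.{v}} (h : (cotensor K X ⟶[SSet.{v}] X') ⟶ Z) :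
    cotensorEv K' X' ≫ eHomWhiskerRight SSet.{v} (cotensorMap k f) X' ≫ h =
      k ≫ cotensorEv K X ≫ eHomWhiskerLeft SSet.{v} _ f ≫ h := by
  rw [← Category.assoc, cotensorMap_fac, Category.assoc, Category.assoc]

lemma cotensorMap_id (K : SSet.{v}) (X : C) : cotensorMap (𝟙 K) (𝟙 X) = 𝟙 _ :=
  cotensor_hom_ext (by simp)

lemma cotensorMap_comp {K K' K'' : SSet.{v}} {X X' X'' : C} (k : K' ⟶ K) (k' : K'' ⟶ K')
    (f : X ⟶ X') (f' : X' ⟶ X'') :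
    cotensorMap k f ≫ cotensorMap k' f' = cotensorMap (k' ≫ k) (f ≫ f') := by
  apply cotensor_hom_ext
  rw [eHomWhiskerRight_comp, cotensorMap_fac_assoc, eHom_whisker_exchange, cotensorMap_fac_assoc,
    cotensorMap_fac, eHomWhiskerLeft_comp]
  simp

lemma cotensorLift_comp_map {A : C} {K K' : SSet.{v}} {X X' : C} (g : K ⟶ (A ⟶[SSet.{v}] X))
    (k : K' ⟶ K) (f : X ⟶ X') :
    cotensorLift g ≫ cotensorMap k f = cotensorLift (k ≫ g ≫ eHomWhiskerLeft SSet.{v} A f) := by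
  apply cotensor_hom_ext
  rw [eHomWhiskerRight_comp, cotensorMap_fac_assoc, eHom_whisker_exchange, cotensorLift_fac_assoc,
    cotensorLift_fac]

lemma comp_cotensorLift {A A' : C} {K : SSet.{v}} {X : C} (a : A' ⟶ A)
    (g : K ⟶ (A ⟶[SSet.{v}] X)) :
    a ≫ cotensorLift g = cotensorLift (g ≫ eHomWhiskerRight SSet.{v} a X) := by
  apply cotensor_hom_ext
  rw [eHomWhiskerRight_comp, cotensorLift_fac_assoc, cotensorLift_fac]

variable (C) in
/-- The cotensor bifunctor `(K, X) ↦ X ^ K`. -/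
@[simps]
def cotensorFunctor : SSet.{v}ᵒᵖ ⥤ C ⥤ C where
  obj K :=
    { obj X := cotensor K.unop X
      map f := cotensorMap (𝟙 _) f
      map_id X := cotensorMap_id _ _
      map_comp f g := by rw [cotensorMap_comp, Category.comp_id] }
  map k :=
    { app X := cotensorMap k.unop (𝟙 X)
      naturality X Y f := by
        rw [cotensorMap_comp, cotensorMap_comp]
        simp }
  map_id K := by
    ext X
    exact cotensorMap_id _ _
  map_comp k k' := by
    ext X
    simp [cotensorMap_comp]

/-- The Leibniz cotensor `X ^ B ⟶ X ^ A ×_{Y ^ A} Y ^ B` of `l : A ⟶ B` and `r : X ⟶ Y`. -/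
def leibnizCotensor [HasPullbacks C] {A B : SSet.{v}} (l : A ⟶ B) {X Y : C} (r : X ⟶ Y) :
    cotensor B X ⟶ pullback (cotensorMap (𝟙 A) r) (cotensorMap l (𝟙 Y)) :=
  pullback.lift (cotensorMap l (𝟙 X)) (cotensorMap (𝟙 B) r) (by
    rw [cotensorMap_comp, cotensorMap_comp]; simp)

end Cotensors

/-! ## Simplicial model categories -/

/-- A simplicial model category: a complete and cocomplete category that is enriched, tensored and
cotensored over simplicial sets, with a model structure such that the Leibniz cotensor of a
cofibration (monomorphism) of simplicial sets and a fibration is a fibration, which is a weak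
equivalence if either of the two maps is. The cofibrations of simplicial sets that are weak
equivalences are the maps with the left lifting property against Kan fibrations
(`SSet.anodyneExtensions`). -/
class SimplicialModelCategory (C : Type u) [Category.{v} C] [SimplicialCategory C]
    [ModelCategory C] : Prop extends
    HasLimits C, HasColimits C, HasTensors C, HasCotensors C where
  leibniz_fibration {A B : SSet.{v}} (l : A ⟶ B) {X Y : C} (r : X ⟶ Y) :
    Mono l → fibrations C r → fibrations C (leibnizCotensor l r)
  leibniz_weakEquivalence_of_left {A B : SSet.{v}} (l : A ⟶ B) {X Y : C} (r : X ⟶ Y) :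
    SSet.anodyneExtensions l → fibrations C r → weakEquivalences C (leibnizCotensor l r)
  leibniz_weakEquivalence_of_right {A B : SSet.{v}} (l : A ⟶ B) {X Y : C} (r : X ⟶ Y) :
    Mono l → trivialFibrations C r → weakEquivalences C (leibnizCotensor l r)

/-- A natural transformation `α : F ⟶ G` of functors between model categories is a Quillen
cofibration if for every cofibration (resp. trivial cofibration) `i : A ⟶ B`, the induced map
`G A ⊔_{F A} F B ⟶ G B` is a cofibration (resp. trivial cofibration). -/
def IsQuillenCofibration {C : Type u₁} [Category.{v} C] [ModelCategory C]
    {D : Type u₂} [Category.{v} D] [ModelCategory D] {F G : C ⥤ D} (α : F ⟶ G) : Prop :=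
  ∀ ⦃A B : C⦄ (i : A ⟶ B),
    (cofibrations C i → cofibrations D
      (pushout.desc (G.map i) (α.app B) (α.naturality i).symm :
        pushout (α.app A) (F.map i) ⟶ G.obj B)) ∧
    (trivialCofibrations C i → trivialCofibrations D
      (pushout.desc (G.map i) (α.app B) (α.naturality i).symm :
        pushout (α.app A) (F.map i) ⟶ G.obj B))

/-! ## Lifted classes of maps -/

section Classes

variable {C : Type u₁} [Category.{v} C] {D : Type u₂} [Category.{v} D] [ModelCategory D]

/-- The `U`-fibrations: the maps whose image under `U` is a fibration. -/
def UFibrations (U : C ⥤ D) : MorphismProperty C := (fibrations D).inverseImage U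

/-- The `U`-trivial cofibrations: the maps whose image under `U` is a trivial cofibration. -/
def UTrivialCofibrations (U : C ⥤ D) : MorphismProperty C :=
  (trivialCofibrations D).inverseImage U

/-- The injective fibrations: the maps with the right lifting property with respect to
the `U`-trivial cofibrations. -/
def injectiveFibrations (U : C ⥤ D) : MorphismProperty C := (UTrivialCofibrations U).rlp

end Classes

/-! ## The cosimplicial resolution of a monad -/

/-- Codes for monotone maps `Fin m → Fin n`. -/
inductive MonoCode : ℕ → ℕ → Type
  /-- the empty map -/
  | nil : MonoCode 0 0
  /-- shift all values by one, so that the value `0` is omitted -/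
  | skip {m n : ℕ} (f : MonoCode m n) : MonoCode m (n + 1)
  /-- add a new first element, with value `0` -/
  | hit {m n : ℕ} (f : MonoCode m (n + 1)) : MonoCode (m + 1) (n + 1)

namespace MonoCode

/-- The monotone map with a given code. -/
def toFun : ∀ {m n : ℕ}, MonoCode m n → Fin m → Fin n
  | _, _, nil => id
  | _, _, skip f => fun i => (f.toFun i).succ
  | _, _, hit f => Fin.cases 0 f.toFun

lemma monotone_toFun : ∀ {m n : ℕ} (f : MonoCode m n), Monotone f.toFun
  | _, _, nil => monotone_id
  | _, _, skip f => fun _ _ h => Fin.succ_le_succ_iff.2 (f.monotone_toFun h)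
  | _, _, hit f => by
    intro i j h
    induction i using Fin.cases with
    | zero => exact Fin.zero_le _
    | succ i =>
      induction j using Fin.cases with
      | zero => simp at h
      | succ j => exact f.monotone_toFun (Fin.succ_le_succ_iff.1 h)

lemma toFun_injective : ∀ {m n : ℕ} (f g : MonoCode m n), f.toFun = g.toFun → f = g
  | _, _, nil, nil, _ => rfl
  | _, _, skip f, skip g, h => by
    rw [toFun_injective f g]
    funext i
    exact Fin.succ_injective _ (congrFun h i)
  | _, _, hit f, hit g, h => by
    rw [toFun_injective f g]
    funext i
    exact congrFun h i.succ
  | _, _, skip f, hit g, h => absurd (congrFun h 0) (Fin.succ_ne_zero _)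
  | _, _, hit f, skip g, h => absurd (congrFun h 0).symm (Fin.succ_ne_zero _)

lemma exists_toFun_eq : ∀ (n m : ℕ) (f : Fin m → Fin n), Monotone f →
    ∃ c : MonoCode m n, c.toFun = f := by
  intro n
  induction n with
  | zero =>
    intro m f _
    cases m with
    | zero => exact ⟨nil, Subsingleton.elim _ _⟩
    | succ m => exact (f 0).elim0
  | succ n ihn =>
    intro m
    induction m with
    | zero =>
      intro f _
      obtain ⟨c, -⟩ := ihn 0 Fin.elim0 (fun i => i.elim0)
      exact ⟨skip c, Subsingleton.elim _ _⟩
    | succ m ihm =>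
      intro f hf
      by_cases h0 : f 0 = 0
      · obtain ⟨c, hc⟩ := ihm (fun i => f i.succ) (fun i j h => hf (Fin.succ_le_succ_iff.2 h))
        refine ⟨hit c, ?_⟩
        funext i
        induction i using Fin.cases with
        | zero => exact h0.symm
        | succ i => exact congrFun hc i
      · have hne (i) : f i ≠ 0 := fun h =>
          h0 (le_antisymm ((hf (Fin.zero_le i)).trans h.le) (Fin.zero_le _))
        obtain ⟨c, hc⟩ := ihn (m + 1) (fun i => (f i).pred (hne i))
          (fun i j h => Fin.pred_le_pred_iff.2 (hf h))
        refine ⟨skip c, ?_⟩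
        funext i
        simp [toFun, hc]

/-- Monotone maps are in bijection with their codes. -/
def equivOrderHom (m n : ℕ) : MonoCode m n ≃ (Fin m →o Fin n) :=
  Equiv.ofBijective (fun c => ⟨c.toFun, c.monotone_toFun⟩)
    ⟨fun f g h => toFun_injective f g (congrArg (fun e : Fin m →o Fin n => (e : Fin m → Fin n)) h),
     fun f => (exists_toFun_eq n m f f.monotone).imp fun _ h => OrderHom.ext _ _ h⟩

/-- The code of a monotone map. -/
def ofOrderHom {m n : ℕ} (f : Fin m →o Fin n) : MonoCode m n := (equivOrderHom m n).symm f

lemma toFun_ofOrderHom {m n : ℕ} (f : Fin m →o Fin n) : (ofOrderHom f).toFun = f :=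
  congrArg (fun e : Fin m →o Fin n => (e : Fin m → Fin n))
    ((equivOrderHom m n).apply_symm_apply f)

/-- The code of an identity map. -/
def idCode : ∀ n : ℕ, MonoCode n n
  | 0 => nil
  | n + 1 => hit (skip (idCode n))

lemma toFun_idCode : ∀ n : ℕ, (idCode n).toFun = id
  | 0 => rfl
  | n + 1 => by
    funext i
    induction i using Fin.cases with
    | zero => rfl
    | succ i => simp [idCode, toFun, toFun_idCode n]

/-- The code of a composition. -/
def comp : ∀ {m n p : ℕ}, MonoCode m n → MonoCode n p → MonoCode m p
  | _, _, _, f, nil => f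
  | _, _, _, f, skip g => skip (comp f g)
  | _, _, _, skip f, hit g => comp f g
  | _, _, _, hit f, hit g => hit (comp f (hit g))

lemma toFun_comp : ∀ {m n p : ℕ} (f : MonoCode m n) (g : MonoCode n p),
    (comp f g).toFun = g.toFun ∘ f.toFun
  | _, _, _, f, nil => by simp [comp, toFun]
  | _, _, _, f, skip g => by
    funext i
    simp [comp, toFun, toFun_comp f g]
  | _, _, _, skip f, hit g => by
    funext i
    simp [comp, toFun, toFun_comp f g]
  | _, _, _, hit f, hit g => by
    funext i
    induction i using Fin.cases with
    | zero => simp [comp, toFun]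
    | succ i =>
      simp only [comp, toFun, Fin.cases_succ, Function.comp_apply]
      rw [toFun_comp f (hit g)]
      rfl

/-- The code of the map from the empty ordinal. -/
def emptyCode : ∀ n : ℕ, MonoCode 0 n
  | 0 => nil
  | n + 1 => skip (emptyCode n)

lemma eq_emptyCode {n : ℕ} (f : MonoCode 0 n) : f = emptyCode n :=
  toFun_injective _ _ (Subsingleton.elim _ _)

end MonoCode

section Monad

variable {C : Type u} [Category.{v} C] (T : Monad C)

/-- The iterates of the endofunctor underlying a monad. -/
def iter : ℕ → C ⥤ C
  | 0 => 𝟭 C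
  | n + 1 => iter n ⋙ T.toFunctor

/-- The action of monotone maps on the iterates of a monad: the free monoidal category on a monoid
acts on `C` via `T`. A value that is omitted is filled in with the unit of `T`, and values
that are taken several times are combined with the multiplication of `T`. -/
def act : ∀ {m n : ℕ}, MonoCode m n → (iter T m ⟶ iter T n)
  | _, _, .nil => 𝟙 _
  | _, _, .skip (n := n) f => act f ≫ (Functor.whiskerLeft (iter T n) T.η : _ ⟶ iter T (n + 1))
  | _, _, .hit (n := n) f =>
    (Functor.whiskerRight (act f) T.toFunctor : _ ⟶ iter T (n + 1) ⋙ T.toFunctor) ≫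
      (Functor.whiskerLeft (iter T n) T.μ : _ ⟶ iter T (n + 1))

lemma act_skip_app {m n : ℕ} (f : MonoCode m n) (X : C) :
    (act T f.skip).app X = (act T f).app X ≫ T.η.app ((iter T n).obj X) := rfl

lemma act_hit_app {m n : ℕ} (f : MonoCode m (n + 1)) (X : C) :
    (act T f.hit).app X = T.map ((act T f).app X) ≫ T.μ.app ((iter T n).obj X) := rfl

lemma monad_aux_unit {A B : C} (g : A ⟶ T.obj B) :
    T.η.app A ≫ T.map g ≫ T.μ.app B = g := by
  have h := T.η.naturality g
  simp only [Functor.id_map] at h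
  rw [← reassoc_of% h, T.left_unit]
  exact Category.comp_id _

lemma monad_aux_mul {A B D : C} (f : A ⟶ T.obj B) (g : B ⟶ T.obj D) :
    T.map (f ≫ T.map g ≫ T.μ.app D) ≫ T.μ.app D =
      (T.map f ≫ T.μ.app B) ≫ T.map g ≫ T.μ.app D := by
  have h := T.μ.naturality g
  simp only [Functor.comp_map] at h
  rw [T.map_comp, T.map_comp, Category.assoc, Category.assoc, Category.assoc, T.assoc,
    ← reassoc_of% h]

lemma act_idCode : ∀ n : ℕ, act T (MonoCode.idCode n) = 𝟙 _
  | 0 => rfl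
  | n + 1 => by
    ext X
    rw [MonoCode.idCode, act_hit_app, act_skip_app, act_idCode n, NatTrans.id_app,
      Category.id_comp]
    exact T.right_unit _

lemma act_comp_app : ∀ {m n p : ℕ} (f : MonoCode m n) (g : MonoCode n p) (X : C),
    (act T (f.comp g)).app X = (act T f).app X ≫ (act T g).app X
  | _, _, _, f, .nil, X => by
    rw [MonoCode.comp]
    exact (Category.comp_id _).symm
  | _, _, _, f, .skip g, X => by
    rw [MonoCode.comp, act_skip_app, act_comp_app f g]
    exact Category.assoc _ _ _
  | _, _, _, .skip f, .hit g, X => by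
    rw [MonoCode.comp, act_comp_app f g, act_skip_app]
    exact (congrArg ((act T f).app X ≫ ·) (monad_aux_unit T ((act T g).app X)).symm).trans
      (Category.assoc _ _ _).symm
  | _, _, _, .hit f, .hit g, X => by
    rw [MonoCode.comp, act_hit_app, act_comp_app f g.hit]
    exact monad_aux_mul T ((act T f).app X) ((act T g).app X)

lemma act_comp {m n p : ℕ} (f : MonoCode m n) (g : MonoCode n p) :
    act T (f.comp g) = act T f ≫ act T g := by
  ext X
  exact act_comp_app T f g X

/-- The (unaugmented) cosimplicial endofunctor `[n] ↦ T^{n+1}` of a monad `T`. -/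
def resolution : SimplexCategory ⥤ C ⥤ C where
  obj n := iter T (n.len + 1)
  map f := act T (MonoCode.ofOrderHom f.toOrderHom)
  map_id n := by
    rw [← act_idCode]
    congr 1
    apply MonoCode.toFun_injective
    rw [MonoCode.toFun_ofOrderHom, MonoCode.toFun_idCode]
    rfl
  map_comp f g := by
    rw [← act_comp]
    congr 1
    apply MonoCode.toFun_injective
    rw [MonoCode.toFun_comp, MonoCode.toFun_ofOrderHom, MonoCode.toFun_ofOrderHom,
      MonoCode.toFun_ofOrderHom]
    rfl

/-- The coaugmentation `id ⟶ T^{n+1}`: the action of the map from the empty ordinal. -/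
def coaugmentation (n : SimplexCategory) : 𝟭 C ⟶ (resolution T).obj n :=
  act T (MonoCode.emptyCode (n.len + 1))

@[simp]
lemma coaugmentation_comp {n m : SimplexCategory} (f : n ⟶ m) :
    coaugmentation T n ≫ (resolution T).map f = coaugmentation T m := by
  refine (act_comp T _ _).symm.trans ?_
  congr 1
  exact MonoCode.eq_emptyCode _

/-- The cosimplicial object `[n] ↦ T^{n+1} X`. -/
def cobarCosimplicial : C ⥤ CosimplicialObject C := (resolution T).flip

end Monad

/-! ## Totalization and the cobar construction -/

section Tot

variable {C : Type u} [Category.{v} C] [SimplicialCategory C] [HasCotensors C]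

/-- The bifunctor `([n], [m]) ↦ (Z^m) ^ Δ[n]` associated with a cosimplicial object `Z`. -/
def totBifunctor (Z : CosimplicialObject C) : SimplexCategoryᵒᵖ ⥤ SimplexCategory ⥤ C :=
  SSet.stdSimplex.{v}.op ⋙ cotensorFunctor C ⋙ (Functor.whiskeringLeft _ _ _).obj Z

/-- Functoriality of `totBifunctor`. -/
def totBifunctorMap {Z W : CosimplicialObject C} (φ : Z ⟶ W) : totBifunctor Z ⟶ totBifunctor W :=
  Functor.whiskerLeft (SSet.stdSimplex.{v}.op ⋙ cotensorFunctor C)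
    ((Functor.whiskeringLeft _ _ _).map φ)

/-- The map `X ⟶ Y ^ K` that is constantly equal to `a : X ⟶ Y`. -/
def constMap {X Y : C} (K : SSet.{v}) (a : X ⟶ Y) : X ⟶ cotensor K Y :=
  cotensorLift (SemiCartesianMonoidalCategory.toUnit K ≫ eHomEquiv SSet.{v} a)

lemma constMap_comp_map {X Y Y' : C} {K K' : SSet.{v}} (a : X ⟶ Y) (k : K' ⟶ K) (f : Y ⟶ Y') :
    constMap K a ≫ cotensorMap k f = constMap K' (a ≫ f) := by
  rw [constMap, cotensorLift_comp_map, constMap, Category.assoc, eHomEquiv_whiskerLeft]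
  congr 1

lemma comp_constMap {X X' Y : C} (K : SSet.{v}) (b : X' ⟶ X) (a : X ⟶ Y) :
    b ≫ constMap K a = constMap K (b ≫ a) := by
  rw [constMap, comp_cotensorLift, constMap, Category.assoc, eHomEquiv_whiskerRight]

variable [HasLimits C]

/-- The totalization `∫_[n] (Z^n) ^ Δ[n]` of a cosimplicial object `Z`. -/
def tot (Z : CosimplicialObject C) : C := end_ (totBifunctor Z)

/-- Functoriality of the totalization. -/
def totMap {Z W : CosimplicialObject C} (φ : Z ⟶ W) : tot Z ⟶ tot W := end_.map (totBifunctorMap φ)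

variable (T : Monad C)

/-- The cobar construction: the totalization of `[n] ↦ T^{n+1} X`. -/
def cobar (X : C) : C := tot ((cobarCosimplicial T).obj X)

/-- Functoriality of the cobar construction. -/
def cobarMap {X Y : C} (f : X ⟶ Y) : cobar T X ⟶ cobar T Y := totMap ((cobarCosimplicial T).map f)

/-- The coaugmentation `ν_X` from `X` to the cobar construction. -/
def cobarUnit (X : C) : X ⟶ cobar T X :=
  end_.lift (F := totBifunctor ((cobarCosimplicial T).obj X))
    (fun n => constMap (SSet.stdSimplex.{v}.obj n) ((coaugmentation T n).app X))
    (fun i j g => by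
      refine (constMap_comp_map _ (𝟙 _) _).trans
        (Eq.trans ?_ (constMap_comp_map _ (SSet.stdSimplex.{v}.map g) (𝟙 _)).symm)
      refine congrArg (constMap (SSet.stdSimplex.{v}.obj i)) (Eq.trans ?_ (Category.comp_id _).symm)
      exact congrArg (fun α => α.app X) (coaugmentation_comp T g))

lemma cobarUnit_naturality {X Y : C} (f : X ⟶ Y) :
    f ≫ cobarUnit T Y = cobarUnit T X ≫ cobarMap T f := by
  apply end_.hom_ext
  intro n
  refine (Category.assoc _ _ _).trans (Eq.trans ?_ (Category.assoc _ _ _).symm)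
  refine (congrArg (f ≫ ·) (end_.lift_π _ _ n)).trans (Eq.trans ?_
    (congrArg (cobarUnit T X ≫ ·) (end_.map_π _ n)).symm)
  refine Eq.trans ?_ (Category.assoc _ _ _)
  refine Eq.trans ?_ (congrArg (· ≫ ((totBifunctorMap ((cobarCosimplicial T).map f)).app
    (op n)).app n) (end_.lift_π _ _ n)).symm
  refine (comp_constMap _ f _).trans (Eq.trans ?_ (constMap_comp_map _ (𝟙 _) _).symm)
  exact congrArg (constMap (SSet.stdSimplex.{v}.obj n)) ((coaugmentation T n).naturality f)

/-- The middle object `E f = Y ×_{C(Y)} C(X)` of the cobar factorization of `f : X ⟶ Y`. -/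
def cobarFactorization {X Y : C} (f : X ⟶ Y) : C := pullback (cobarMap T f) (cobarUnit T Y)

/-- The left map `λ_f : X ⟶ E f` of the cobar factorization. -/
def cobarLeft {X Y : C} (f : X ⟶ Y) : X ⟶ cobarFactorization T f :=
  pullback.lift (cobarUnit T X) f (cobarUnit_naturality T f).symm

/-- The right map `ρ_f : E f ⟶ Y` of the cobar factorization. -/
def cobarRight {X Y : C} (f : X ⟶ Y) : cobarFactorization T f ⟶ Y := pullback.snd _ _

lemma cobarLeft_comp_cobarRight {X Y : C} (f : X ⟶ Y) : cobarLeft T f ≫ cobarRight T f = f :=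
  pullback.lift_snd _ _ _

end Tot

end InjFib

end

/-! Two facts about the cobar factorization carry the proof: `λ_f` is always a `U`-trivial
cofibration, and `ρ_f` is an injective fibration whenever `f` is a `U`-fibration. An injective
fibration then lifts against `λ_f`, and this lift is a retraction over `Y`; conversely, a retraction
over `Y` exhibits `f` as a retract of `ρ_f`. An injective fibration is a `U`-fibration because `U L`
preserves trivial cofibrations, the unit being a Quillen cofibration.

For `ρ_f`, a pullback of `C(R, UR, Uf)`, the argument is a Reedy induction
(`injectiveFibrations_cobarMap`). Let `U i` be a trivial cofibration, with `i : A ⟶ B`. A map from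
`B` to a totalization is a natural family of maps from `Δ[n]` to `Map(B, Z n)`. A lift is built
dimension by dimension, with prescribed values on the boundary of `Δ[n]` and prescribed images under
the codegeneracies (`exists_cosimplicial_lift`). Transposing along `U ⊣ R` turns each step into
lifting the pushout product of the boundary inclusion and `U i`, a trivial cofibration of `N`,
against a relative matching map of the objects `U (R U)ⁿ X`. That these matching maps behave as
fibrations is `exists_matching_lift`: transposing along `U L ⊣ U R` replaces a trivial cofibration
`P ⟶ Q` by `U L P ⊔_P Q ⟶ U L Q`, which is one again by the hypothesis on the unit, and lowers the
dimension by one. What remains at the end is lifting against `U f`.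

For `λ_f`, the counit of `U ⊣ R` gives extra codegeneracies on `U X ⟶ U (R U)ⁿ⁺¹ X`. Since `U` has a
simplicial left adjoint, it preserves totalizations. Hence `U X` is a strong deformation retract of
`U C(R, UR, UX)`, naturally in `X`, and so also of `U (E f)`. The map `U λ_f` is thus a split
monomorphism, hence a cofibration, and the deformation makes it trivial
(`trivialCofibrations_of_deformationRetract`). -/

noncomputable section

namespace InjFib

/-! ### Simplicial functors and adjunctions on simplicial hom-sets -/

section EnrichedBasics

variable {C : Type u₁} [Category.{v} C] [SimplicialCategory C]
variable {D : Type u₂} [Category.{v} D] [SimplicialCategory D]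

/-- The action on morphisms of a simplicial functor. -/
def umap (F : EnrichedFunctor SSet.{v} C D) {X Y : C} (f : X ⟶ Y) : F.obj X ⟶ F.obj Y :=
  (underlying F).map f

@[simp]
lemma umap_id (F : EnrichedFunctor SSet.{v} C D) (X : C) : umap F (𝟙 X) = 𝟙 (F.obj X) :=
  (underlying F).map_id X

lemma umap_comp (F : EnrichedFunctor SSet.{v} C D) {X Y Z : C} (f : X ⟶ Y) (g : Y ⟶ Z) :
    umap F (f ≫ g) = umap F f ≫ umap F g :=
  (underlying F).map_comp f g

lemma eHomEquiv_umap (F : EnrichedFunctor SSet.{v} C D) {X Y : C} (f : X ⟶ Y) :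
    eHomEquiv SSet.{v} (umap F f) = eHomEquiv SSet.{v} f ≫ F.map X Y :=
  (eHomEquiv SSet.{v}).apply_symm_apply _

lemma eHomWhiskerLeft_enrichedMap (F : EnrichedFunctor SSet.{v} C D) (X : C) {Y Y' : C}
    (g : Y ⟶ Y') :
    eHomWhiskerLeft SSet.{v} X g ≫ F.map X Y' =
      F.map X Y ≫ eHomWhiskerLeft SSet.{v} (F.obj X) (umap F g) := by
  dsimp only [eHomWhiskerLeft]
  rw [eHomEquiv_umap]
  rw [Category.assoc, Category.assoc, F.map_comp, rightUnitor_inv_naturality_assoc,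
    MonoidalCategory.tensorHom_def, MonoidalCategory.whiskerLeft_comp, Category.assoc,
    Category.assoc, whisker_exchange_assoc]

lemma eHomWhiskerLeft_enrichedMap_assoc (F : EnrichedFunctor SSet.{v} C D) (X : C) {Y Y' : C}
    (g : Y ⟶ Y') {Z : SSet.{v}} (h : (F.obj X ⟶[SSet.{v}] F.obj Y') ⟶ Z) :
    eHomWhiskerLeft SSet.{v} X g ≫ F.map X Y' ≫ h =
      F.map X Y ≫ eHomWhiskerLeft SSet.{v} (F.obj X) (umap F g) ≫ h := by
  simpa only [Category.assoc] using eHomWhiskerLeft_enrichedMap F X g =≫ h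

lemma eHomWhiskerRight_enrichedMap (F : EnrichedFunctor SSet.{v} C D) {X X' : C} (g : X ⟶ X')
    (Y : C) :
    eHomWhiskerRight SSet.{v} g Y ≫ F.map X Y =
      F.map X' Y ≫ eHomWhiskerRight SSet.{v} (umap F g) (F.obj Y) := by
  dsimp only [eHomWhiskerRight]
  rw [eHomEquiv_umap]
  rw [Category.assoc, Category.assoc, F.map_comp, leftUnitor_inv_naturality_assoc,
    MonoidalCategory.tensorHom_def', MonoidalCategory.comp_whiskerRight, Category.assoc,
    Category.assoc, ← whisker_exchange_assoc]

lemma eHomWhiskerRight_enrichedMap_assoc (F : EnrichedFunctor SSet.{v} C D) {X X' : C}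
    (g : X ⟶ X') (Y : C) {Z : SSet.{v}} (h : (F.obj X ⟶[SSet.{v}] F.obj Y) ⟶ Z) :
    eHomWhiskerRight SSet.{v} g Y ≫ F.map X Y ≫ h =
      F.map X' Y ≫ eHomWhiskerRight SSet.{v} (umap F g) (F.obj Y) ≫ h := by
  simpa only [Category.assoc] using eHomWhiskerRight_enrichedMap F g Y =≫ h

namespace SimplicialAdjunction

variable {F : EnrichedFunctor SSet.{v} C D} {G : EnrichedFunctor SSet.{v} D C}
  (adj : SimplicialAdjunction F G)

/-- The counit of a simplicial adjunction. -/
def ε (Y : D) : F.obj (G.obj Y) ⟶ Y := adj.adj.counit.app Y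

/-- The unit of a simplicial adjunction. -/
def η (X : C) : X ⟶ G.obj (F.obj X) := adj.adj.unit.app X

lemma ε_naturality {Y Y' : D} (g : Y ⟶ Y') :
    umap F (umap G g) ≫ adj.ε Y' = adj.ε Y ≫ g :=
  adj.adj.counit.naturality g

lemma η_naturality {X X' : C} (g : X ⟶ X') :
    g ≫ adj.η X' = adj.η X ≫ umap G (umap F g) :=
  adj.adj.unit.naturality g

lemma η_naturality_assoc {X X' : C} (g : X ⟶ X') {Z : C} (h : G.obj (F.obj X') ⟶ Z) :
    g ≫ adj.η X' ≫ h = adj.η X ≫ umap G (umap F g) ≫ h := by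
  simpa only [Category.assoc] using adj.η_naturality g =≫ h

@[simp]
lemma left_triangle (X : C) : umap F (adj.η X) ≫ adj.ε (F.obj X) = 𝟙 (F.obj X) :=
  adj.adj.left_triangle_components X

lemma left_triangle_assoc (X : C) {Z : D} (h : F.obj X ⟶ Z) :
    umap F (adj.η X) ≫ adj.ε (F.obj X) ≫ h = h := by
  simpa only [Category.assoc, Category.id_comp] using adj.left_triangle X =≫ h

@[simp]
lemma right_triangle (Y : D) : adj.η (G.obj Y) ≫ umap G (adj.ε Y) = 𝟙 (G.obj Y) :=
  adj.adj.right_triangle_components Y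

lemma right_triangle_assoc (Y : D) {Z : C} (h : G.obj Y ⟶ Z) :
    adj.η (G.obj Y) ≫ umap G (adj.ε Y) ≫ h = h := by
  simpa only [Category.assoc, Category.id_comp] using adj.right_triangle Y =≫ h

/-- The transposition map `Map(X, G Y) ⟶ Map(F X, Y)`. -/
def toLeft (X : C) (Y : D) : (X ⟶[SSet.{v}] G.obj Y) ⟶ (F.obj X ⟶[SSet.{v}] Y) :=
  F.map X (G.obj Y) ≫ eHomWhiskerLeft SSet.{v} (F.obj X) (adj.ε Y)

/-- The transposition map `Map(F X, Y) ⟶ Map(X, G Y)`. -/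
def toRight (X : C) (Y : D) : (F.obj X ⟶[SSet.{v}] Y) ⟶ (X ⟶[SSet.{v}] G.obj Y) :=
  G.map (F.obj X) Y ≫ eHomWhiskerRight SSet.{v} (adj.η X) (G.obj Y)

-- Simplicial naturality of the counit turns the composite into restriction along `F η ≫ ε`, which
-- is the identity by a triangle identity. The underlying adjunction alone would give this on
-- vertices only.
@[simp]
lemma toRight_toLeft (X : C) (Y : D) : adj.toRight X Y ≫ adj.toLeft X Y = 𝟙 _ := by
  dsimp only [toRight, toLeft]
  have h := adj.counit_naturality (F.obj X) Y
  have h' : eHomWhiskerRight SSet.{v} (adj.ε (F.obj X)) Y =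
      G.map (F.obj X) Y ≫ F.map (G.obj (F.obj X)) (G.obj Y) ≫
        eHomWhiskerLeft SSet.{v} (F.obj (G.obj (F.obj X))) (adj.ε Y) := h
  rw [Category.assoc, eHomWhiskerRight_enrichedMap_assoc]
  rw [← eHom_whisker_exchange, ← Category.assoc (F.map _ _), ← Category.assoc (G.map _ _)]
  have e : eHomWhiskerRight SSet.{v} (adj.ε (F.obj X)) Y ≫
      eHomWhiskerRight SSet.{v} (umap F (adj.η X)) Y = 𝟙 _ := by
    rw [← eHomWhiskerRight_comp, left_triangle, eHomWhiskerRight_id]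
  rw [h'] at e
  exact e

@[simp]
lemma toLeft_toRight (X : C) (Y : D) : adj.toLeft X Y ≫ adj.toRight X Y = 𝟙 _ := by
  dsimp only [toRight, toLeft]
  have h : eHomWhiskerLeft SSet.{v} X (adj.η (G.obj Y)) =
      F.map X (G.obj Y) ≫ G.map (F.obj X) (F.obj (G.obj Y)) ≫
        eHomWhiskerRight SSet.{v} (adj.η X) (G.obj (F.obj (G.obj Y))) :=
    adj.unit_naturality X (G.obj Y)
  rw [Category.assoc, eHomWhiskerLeft_enrichedMap_assoc]
  rw [eHom_whisker_exchange, ← Category.assoc (G.map _ _), ← Category.assoc (F.map _ _)]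
  have e : eHomWhiskerLeft SSet.{v} X (adj.η (G.obj Y)) ≫
      eHomWhiskerLeft SSet.{v} X (umap G (adj.ε Y)) = 𝟙 _ := by
    rw [← eHomWhiskerLeft_comp, right_triangle, eHomWhiskerLeft_id]
  rw [h] at e
  exact e

lemma toLeft_whiskerLeft (X : C) {Y Y' : D} (g : Y ⟶ Y') :
    adj.toLeft X Y ≫ eHomWhiskerLeft SSet.{v} (F.obj X) g =
      eHomWhiskerLeft SSet.{v} X (umap G g) ≫ adj.toLeft X Y' := by
  dsimp only [toLeft]
  rw [eHomWhiskerLeft_enrichedMap_assoc, Category.assoc, ← eHomWhiskerLeft_comp,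
    ← eHomWhiskerLeft_comp, ε_naturality]

lemma toLeft_whiskerRight {X X' : C} (f : X ⟶ X') (Y : D) :
    adj.toLeft X' Y ≫ eHomWhiskerRight SSet.{v} (umap F f) Y =
      eHomWhiskerRight SSet.{v} f (G.obj Y) ≫ adj.toLeft X Y := by
  dsimp only [toLeft]
  rw [eHomWhiskerRight_enrichedMap_assoc, Category.assoc, eHom_whisker_exchange]

instance (X : C) (Y : D) : IsIso (adj.toLeft X Y) :=
  ⟨adj.toRight X Y, adj.toLeft_toRight X Y, adj.toRight_toLeft X Y⟩

end SimplicialAdjunction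

end EnrichedBasics

/-! ### Constant maps, tensors, and pullbacks of simplicial hom-sets -/

section Tensors

variable {C : Type u} [Category.{v} C] [SimplicialCategory C]

/-- The constant map `K ⟶ Map(X, Y)` at `f : X ⟶ Y`. -/
def constHom (K : SSet.{v}) {X Y : C} (f : X ⟶ Y) : K ⟶ (X ⟶[SSet.{v}] Y) :=
  SemiCartesianMonoidalCategory.toUnit K ≫ eHomEquiv SSet.{v} f

@[simp]
lemma comp_constHom {K L : SSet.{v}} (k : K ⟶ L) {X Y : C} (f : X ⟶ Y) :
    k ≫ constHom L f = constHom K f := by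
  rw [constHom, ← Category.assoc]
  congr 1

@[simp]
lemma constHom_whiskerLeft (K : SSet.{v}) {X Y Z : C} (f : X ⟶ Y) (g : Y ⟶ Z) :
    constHom K f ≫ eHomWhiskerLeft SSet.{v} X g = constHom K (f ≫ g) := by
  rw [constHom, Category.assoc, eHomEquiv_whiskerLeft, constHom]

@[simp]
lemma constHom_whiskerRight (K : SSet.{v}) {X Y Z : C} (f : X ⟶ Y) (g : Y ⟶ Z) :
    constHom K g ≫ eHomWhiskerRight SSet.{v} f Z = constHom K (f ≫ g) := by
  rw [constHom, Category.assoc, eHomEquiv_whiskerRight, constHom]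

lemma constHom_unit {X Y : C} (f : X ⟶ Y) :
    constHom (𝟙_ SSet.{v}) f = eHomEquiv SSet.{v} f := by
  have h : SemiCartesianMonoidalCategory.toUnit (𝟙_ SSet.{v}) = 𝟙 _ :=
    SemiCartesianMonoidalCategory.toUnit_unique _ _
  rw [constHom, h, Category.id_comp]

lemma constHom_enrichedMap {D : Type u₂} [Category.{v} D] [SimplicialCategory D]
    (F : EnrichedFunctor SSet.{v} C D) (K : SSet.{v}) {X Y : C} (f : X ⟶ Y) :
    constHom K f ≫ F.map X Y = constHom K (umap F f) := by
  rw [constHom, Category.assoc, constHom, eHomEquiv_umap]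

lemma Tensor.bijective_hom {K : SSet.{v}} {X : C} (t : Tensor K X) (A : C) :
    Function.Bijective
      (fun f : t.obj ⟶ A => t.coev ≫ eHomWhiskerLeft SSet.{v} X f) := by
  have h := ((t.bijective A (𝟙_ SSet.{v})).comp
    (eHomEquiv SSet.{v} (X := t.obj) (Y := A)).bijective)
  have h' : Function.Bijective (fun g : K ⊗ 𝟙_ SSet.{v} ⟶ (X ⟶[SSet.{v}] A) => (ρ_ K).inv ≫ g) :=
    ⟨fun g g' hg => by simpa using hg, fun g => ⟨(ρ_ K).hom ≫ g, by simp⟩⟩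
  convert h'.comp h using 1
  funext f
  change t.coev ≫ (ρ_ _).inv ≫ _ ◁ eHomEquiv SSet.{v} f ≫ eComp SSet.{v} X t.obj A =
    (ρ_ K).inv ≫ (t.coev ⊗ₘ eHomEquiv SSet.{v} f) ≫ eComp SSet.{v} X t.obj A
  rw [MonoidalCategory.tensorHom_def, rightUnitor_inv_naturality_assoc, Category.assoc]

variable [HasTensors C]

/-- The chosen tensor. -/
def theTensor (K : SSet.{v}) (X : C) : Tensor K X :=
  (HasTensors.nonempty_tensor K X).some

/-- The object `K ⊗ X`. -/
def tensor (K : SSet.{v}) (X : C) : C := (theTensor K X).obj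

/-- The universal map `K ⟶ Map(X, K ⊗ X)`. -/
def tensorCoev (K : SSet.{v}) (X : C) : K ⟶ (X ⟶[SSet.{v}] tensor K X) := (theTensor K X).coev

/-- Maps `K ⊗ X ⟶ A` correspond to maps `K ⟶ Map(X, A)`. -/
def tensorHomEquiv (K : SSet.{v}) (X A : C) : (tensor K X ⟶ A) ≃ (K ⟶ (X ⟶[SSet.{v}] A)) :=
  Equiv.ofBijective (fun f => tensorCoev K X ≫ eHomWhiskerLeft SSet.{v} X f)
    ((theTensor K X).bijective_hom A)

/-- The map `K ⊗ X ⟶ A` induced by `K ⟶ Map(X, A)`. -/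
def tensorDesc {K : SSet.{v}} {X A : C} (g : K ⟶ (X ⟶[SSet.{v}] A)) : tensor K X ⟶ A :=
  (tensorHomEquiv K X A).symm g

@[simp]
lemma tensorDesc_fac {K : SSet.{v}} {X A : C} (g : K ⟶ (X ⟶[SSet.{v}] A)) :
    tensorCoev K X ≫ eHomWhiskerLeft SSet.{v} X (tensorDesc g) = g :=
  (tensorHomEquiv K X A).apply_symm_apply g

lemma tensorDesc_fac_assoc {K : SSet.{v}} {X A : C} (g : K ⟶ (X ⟶[SSet.{v}] A)) {Z : SSet.{v}}
    (h : (X ⟶[SSet.{v}] A) ⟶ Z) :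
    tensorCoev K X ≫ eHomWhiskerLeft SSet.{v} X (tensorDesc g) ≫ h = g ≫ h := by
  rw [← Category.assoc, tensorDesc_fac]

lemma tensor_hom_ext {K : SSet.{v}} {X A : C} {f g : tensor K X ⟶ A}
    (h : tensorCoev K X ≫ eHomWhiskerLeft SSet.{v} X f =
      tensorCoev K X ≫ eHomWhiskerLeft SSet.{v} X g) : f = g :=
  (tensorHomEquiv K X A).injective h

lemma tensorDesc_injective {K : SSet.{v}} {X A : C} {f g : K ⟶ (X ⟶[SSet.{v}] A)}
    (h : tensorDesc f = tensorDesc g) : f = g :=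
  (tensorHomEquiv K X A).symm.injective h

/-- The map `K ⊗ X ⟶ K' ⊗ X'` induced by `K ⟶ K'` and `X ⟶ X'`. -/
def tensorMap {K K' : SSet.{v}} {X X' : C} (k : K ⟶ K') (f : X ⟶ X') :
    tensor K X ⟶ tensor K' X' :=
  tensorDesc (k ≫ tensorCoev K' X' ≫ eHomWhiskerRight SSet.{v} f _)

lemma tensorDesc_comp {K : SSet.{v}} {X A A' : C} (g : K ⟶ (X ⟶[SSet.{v}] A)) (a : A ⟶ A') :
    tensorDesc g ≫ a = tensorDesc (g ≫ eHomWhiskerLeft SSet.{v} X a) := by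
  apply tensor_hom_ext
  rw [eHomWhiskerLeft_comp, tensorDesc_fac_assoc, tensorDesc_fac]

lemma tensorMap_desc {K K' : SSet.{v}} {X X' A : C} (k : K ⟶ K') (f : X ⟶ X')
    (g : K' ⟶ (X' ⟶[SSet.{v}] A)) :
    tensorMap k f ≫ tensorDesc g = tensorDesc (k ≫ g ≫ eHomWhiskerRight SSet.{v} f A) := by
  rw [tensorMap, tensorDesc_comp, Category.assoc, Category.assoc, ← eHom_whisker_exchange,
    tensorDesc_fac_assoc]

lemma tensorDesc_coev (K : SSet.{v}) {X A : C} (f : tensor K X ⟶ A) :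
    tensorDesc (tensorCoev K X ≫ eHomWhiskerLeft SSet.{v} X f) = f :=
  tensor_hom_ext (tensorDesc_fac _)

lemma tensorMap_comp {K K' K'' : SSet.{v}} {X X' X'' : C} (k : K ⟶ K') (k' : K' ⟶ K'')
    (f : X ⟶ X') (f' : X' ⟶ X'') :
    tensorMap k f ≫ tensorMap k' f' = tensorMap (k ≫ k') (f ≫ f') := by
  rw [tensorMap.eq_1 k' f', tensorMap_desc, tensorMap]
  simp

/-- Maps `K ⟶ Map(X, P)` into a pullback `P` are determined by their projections. -/
lemma sHom_pullback_hom_ext {P A B S X : C} {fst : P ⟶ A} {snd : P ⟶ B} {f : A ⟶ S} {g : B ⟶ S}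
    (h : IsPullback fst snd f g) {K : SSet.{v}} {a b : K ⟶ (X ⟶[SSet.{v}] P)}
    (h₁ : a ≫ eHomWhiskerLeft SSet.{v} X fst = b ≫ eHomWhiskerLeft SSet.{v} X fst)
    (h₂ : a ≫ eHomWhiskerLeft SSet.{v} X snd = b ≫ eHomWhiskerLeft SSet.{v} X snd) : a = b := by
  apply tensorDesc_injective
  apply h.hom_ext
  · rw [tensorDesc_comp, tensorDesc_comp, h₁]
  · rw [tensorDesc_comp, tensorDesc_comp, h₂]

/-- A map `K ⟶ Map(X, P)` into a pullback `P` can be given by its projections. -/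
lemma exists_sHom_pullback_lift {P A B S X : C} {fst : P ⟶ A} {snd : P ⟶ B} {f : A ⟶ S}
    {g : B ⟶ S} (h : IsPullback fst snd f g) {K : SSet.{v}} (a : K ⟶ (X ⟶[SSet.{v}] A))
    (b : K ⟶ (X ⟶[SSet.{v}] B))
    (hab : a ≫ eHomWhiskerLeft SSet.{v} X f = b ≫ eHomWhiskerLeft SSet.{v} X g) :
    ∃ c : K ⟶ (X ⟶[SSet.{v}] P), c ≫ eHomWhiskerLeft SSet.{v} X fst = a ∧
      c ≫ eHomWhiskerLeft SSet.{v} X snd = b := by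
  refine ⟨tensorCoev K X ≫ eHomWhiskerLeft SSet.{v} X (h.lift (tensorDesc a) (tensorDesc b) ?_),
    ?_, ?_⟩
  · rw [tensorDesc_comp, tensorDesc_comp, hab]
  · rw [Category.assoc, ← eHomWhiskerLeft_comp, h.lift_fst, tensorDesc_fac]
  · rw [Category.assoc, ← eHomWhiskerLeft_comp, h.lift_snd, tensorDesc_fac]

end Tensors

/-! ### Lifting properties in a simplicial model category -/

section SimplicialLifting

variable {C : Type u} [Category.{v} C] [SimplicialCategory C]

/-- Lifting against a Leibniz cotensor, in terms of simplicial hom-sets. -/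
lemma exists_sHom_lift [HasCotensors C] [HasPullbacks C] {K L : SSet.{v}} (l : K ⟶ L)
    {A B E F : C} (j : A ⟶ B) (p : E ⟶ F) [HasLiftingProperty j (leibnizCotensor l p)]
    (k : K ⟶ (B ⟶[SSet.{v}] E)) (a : L ⟶ (A ⟶[SSet.{v}] E)) (b : L ⟶ (B ⟶[SSet.{v}] F))
    (hka : l ≫ a = k ≫ eHomWhiskerRight SSet.{v} j E)
    (hkb : k ≫ eHomWhiskerLeft SSet.{v} B p = l ≫ b)
    (hab : a ≫ eHomWhiskerLeft SSet.{v} A p = b ≫ eHomWhiskerRight SSet.{v} j F) :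
    ∃ c : L ⟶ (B ⟶[SSet.{v}] E), l ≫ c = k ∧ c ≫ eHomWhiskerRight SSet.{v} j E = a ∧
      c ≫ eHomWhiskerLeft SSet.{v} B p = b := by
  -- A map from `B` into the target of the Leibniz cotensor is a pair `(k, b)` agreeing over `F ^
  -- K`, so the given data form a square from `j` to the Leibniz cotensor.
  let bot : B ⟶ pullback (cotensorMap (𝟙 K) p) (cotensorMap l (𝟙 F)) :=
    pullback.lift (cotensorLift k) (cotensorLift b) (by
      rw [cotensorLift_comp_map, cotensorLift_comp_map]; simp [hkb])
  have sq : CommSq (cotensorLift a) j (leibnizCotensor l p) bot := ⟨by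
    dsimp only [leibnizCotensor, bot]
    ext
    · simp only [Category.assoc, pullback.lift_fst]
      rw [cotensorLift_comp_map, comp_cotensorLift]
      simp [hka]
    · simp only [Category.assoc, pullback.lift_snd]
      rw [cotensorLift_comp_map, comp_cotensorLift]
      simp [hab]⟩
  have h₁ : sq.lift ≫ cotensorMap l (𝟙 E) = cotensorLift k := by
    have := sq.fac_right =≫ pullback.fst _ _
    dsimp only [leibnizCotensor, bot] at this
    simp only [Category.assoc, pullback.lift_fst] at this
    exact this
  have h₂ : sq.lift ≫ cotensorMap (𝟙 L) p = cotensorLift b := by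
    have := sq.fac_right =≫ pullback.snd _ _
    dsimp only [leibnizCotensor, bot] at this
    simp only [Category.assoc, pullback.lift_snd] at this
    exact this
  refine ⟨cotensorEv L E ≫ eHomWhiskerRight SSet.{v} sq.lift E, ?_, ?_, ?_⟩
  · have := congrArg (fun f => cotensorEv K E ≫ eHomWhiskerRight SSet.{v} f E) h₁
    simp only [cotensorLift_fac, eHomWhiskerRight_comp, cotensorMap_fac_assoc] at this
    simpa using this
  · rw [Category.assoc, ← eHomWhiskerRight_comp, sq.fac_left, cotensorLift_fac]
  · have := congrArg (fun f => cotensorEv L F ≫ eHomWhiskerRight SSet.{v} f F) h₂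
    simp only [cotensorLift_fac, eHomWhiskerRight_comp, cotensorMap_fac_assoc,
      eHom_whisker_exchange] at this
    simpa using this

variable [ModelCategory C] [SimplicialModelCategory C]

/-- The pushout product of a monomorphism of simplicial sets and a trivial cofibration is
a trivial cofibration. -/
lemma trivialCofibrations_pushoutProduct {K L : SSet.{v}} (l : K ⟶ L) [Mono l] {A B : C}
    (j : A ⟶ B) (hj : trivialCofibrations C j)
    (w : tensorMap (𝟙 K) j ≫ tensorMap l (𝟙 B) = tensorMap l (𝟙 A) ≫ tensorMap (𝟙 L) j) :
    trivialCofibrations C (pushout.desc (tensorMap l (𝟙 B)) (tensorMap (𝟙 L) j) w) := by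
  rw [← fibrations_llp]
  intro E F p hp
  -- By adjunction, lifting the pushout product of `l` and `j` against `p` amounts to lifting `j`
  -- against the Leibniz cotensor of `l` and `p`, which is a fibration.
  have : HasLiftingProperty j (leibnizCotensor l p) := by
    rw [← fibrations_llp] at hj
    exact hj _ (SimplicialModelCategory.leibniz_fibration l p inferInstance hp)
  refine ⟨fun {f g} sq => ?_⟩
  let k := tensorCoev K B ≫ eHomWhiskerLeft SSet.{v} B (pushout.inl _ _ ≫ f)
  let a := tensorCoev L A ≫ eHomWhiskerLeft SSet.{v} A (pushout.inr _ _ ≫ f)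
  let b := tensorCoev L B ≫ eHomWhiskerLeft SSet.{v} B g
  have hk : tensorDesc k = pushout.inl _ _ ≫ f := tensorDesc_coev K _
  have ha : tensorDesc a = pushout.inr _ _ ≫ f := tensorDesc_coev L _
  have hb : tensorDesc b = g := tensorDesc_coev L _
  obtain ⟨c, hc₁, hc₂, hc₃⟩ := exists_sHom_lift l j p k a b
    (by
      apply tensorDesc_injective
      have h₁ := tensorMap_desc l (𝟙 A) a
      have h₂ := tensorMap_desc (𝟙 K) j k
      simp only [eHomWhiskerRight_id, Category.comp_id, Category.id_comp] at h₁ h₂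
      rw [← h₁, ← h₂, ha, hk, pushout.condition_assoc])
    (by
      apply tensorDesc_injective
      have h₁ := tensorMap_desc l (𝟙 B) b
      simp only [eHomWhiskerRight_id, Category.comp_id] at h₁
      rw [← tensorDesc_comp, ← h₁, hk, hb, Category.assoc, sq.w, pushout.inl_desc_assoc])
    (by
      apply tensorDesc_injective
      have h₁ := tensorMap_desc (𝟙 L) j b
      simp only [Category.id_comp] at h₁
      rw [← tensorDesc_comp, ← h₁, ha, hb, Category.assoc, sq.w, pushout.inr_desc_assoc])
  refine ⟨⟨⟨tensorDesc c, ?_, ?_⟩⟩⟩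
  · apply pushout.hom_ext
    · rw [pushout.inl_desc_assoc, tensorMap_desc, ← hk]
      simp [hc₁]
    · rw [pushout.inr_desc_assoc, tensorMap_desc, ← ha]
      simp [hc₂]
  · rw [tensorDesc_comp, hc₃, hb]

/-- A cofibration that is the inclusion of a strong deformation retract is a trivial cofibration.
The homotopy is given in terms of an anodyne extension `l : K ⟶ L` and a point of `L`. -/
lemma trivialCofibrations_of_deformationRetract {A B : C} (i : A ⟶ B) (hi : cofibrations C i)
    {K L : SSet.{v}} (l : K ⟶ L) (hl : SSet.anodyneExtensions l) (hl' : Mono l)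
    (e : 𝟙_ SSet.{v} ⟶ L)
    (s : B ⟶ A) (his : i ≫ s = 𝟙 A) (h : L ⟶ (B ⟶[SSet.{v}] B))
    (h₀ : l ≫ h = constHom K (s ≫ i)) (h₁ : e ≫ h = eHomEquiv SSet.{v} (𝟙 B))
    (h₂ : h ≫ eHomWhiskerRight SSet.{v} i B = constHom L i) :
    trivialCofibrations C i := by
  rw [← fibrations_llp]
  intro E F p hp
  have : HasLiftingProperty i (leibnizCotensor l p) := by
    rw [← trivialFibrations_llp] at hi
    exact hi _ ⟨SimplicialModelCategory.leibniz_fibration l p hl' hp,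
      SimplicialModelCategory.leibniz_weakEquivalence_of_left l p hl hp⟩
  refine ⟨fun {f g} sq => ?_⟩
  -- The homotopy `h` followed by `g` is lifted along `p`, starting from `s ≫ f` over `K` and
  -- relative to `A`, where it is constant at `f`. The value of the lift at `e` is the diagonal.
  obtain ⟨c, -, hc₂, hc₃⟩ := exists_sHom_lift l i p (constHom K (s ≫ f)) (constHom L f)
    (h ≫ eHomWhiskerLeft SSet.{v} B g)
    (by rw [comp_constHom, constHom_whiskerRight, reassoc_of% his])
    (by rw [constHom_whiskerLeft, reassoc_of% h₀, constHom_whiskerLeft, Category.assoc,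
      Category.assoc, sq.w])
    (by rw [Category.assoc, eHom_whisker_exchange, reassoc_of% h₂, constHom_whiskerLeft,
      constHom_whiskerLeft, sq.w])
  refine ⟨⟨⟨(eHomEquiv SSet.{v}).symm (e ≫ c), ?_, ?_⟩⟩⟩
  · apply (eHomEquiv SSet.{v}).injective
    rw [← eHomEquiv_whiskerRight, Equiv.apply_symm_apply, Category.assoc, hc₂, comp_constHom,
      constHom_unit]
  · apply (eHomEquiv SSet.{v}).injective
    rw [← eHomEquiv_whiskerLeft, Equiv.apply_symm_apply, Category.assoc, hc₃, reassoc_of% h₁,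
      eHomEquiv_whiskerLeft, Category.id_comp]

end SimplicialLifting

/-! ### Transposition along the composite adjunction `U L ⊣ U R` -/

section Transpose

variable {M : Type u₁} [Category.{v} M] [SimplicialCategory M]
variable {N : Type u₂} [Category.{v} N] [SimplicialCategory N]
variable {U : EnrichedFunctor SSet.{v} M N} {L R : EnrichedFunctor SSet.{v} N M}
  (adjLU : SimplicialAdjunction L U) (adjUR : SimplicialAdjunction U R)

/-- The transpose `U L Q ⟶ V` of a map `Q ⟶ U R V`. -/
def flat {Q V : N} (g : Q ⟶ U.obj (R.obj V)) : U.obj (L.obj Q) ⟶ V :=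
  umap U (umap L g ≫ adjLU.ε (R.obj V)) ≫ adjUR.ε V

/-- The transpose `Q ⟶ U R V` of a map `U L Q ⟶ V`. -/
def sharp {Q V : N} (g : U.obj (L.obj Q) ⟶ V) : Q ⟶ U.obj (R.obj V) :=
  adjLU.η Q ≫ umap U (adjUR.η (L.obj Q) ≫ umap R g)

@[simp]
lemma flat_sharp {Q V : N} (g : U.obj (L.obj Q) ⟶ V) :
    flat adjLU adjUR (sharp adjLU adjUR g) = g := by
  dsimp only [flat, sharp]
  rw [umap_comp L, Category.assoc, adjLU.ε_naturality, adjLU.left_triangle_assoc, umap_comp,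
    Category.assoc, adjUR.ε_naturality, adjUR.left_triangle_assoc]

@[simp]
lemma sharp_flat {Q V : N} (g : Q ⟶ U.obj (R.obj V)) :
    sharp adjLU adjUR (flat adjLU adjUR g) = g := by
  dsimp only [flat, sharp]
  rw [umap_comp R, ← Category.assoc (adjUR.η _), ← adjUR.η_naturality, Category.assoc,
    adjUR.right_triangle, Category.comp_id, umap_comp, ← Category.assoc, ← adjLU.η_naturality,
    Category.assoc, adjLU.right_triangle, Category.comp_id]

lemma flat_comp_left {P Q V : N} (j : P ⟶ Q) (g : Q ⟶ U.obj (R.obj V)) :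
    flat adjLU adjUR (j ≫ g) = umap U (umap L j) ≫ flat adjLU adjUR g := by
  dsimp only [flat]
  rw [umap_comp L, Category.assoc, umap_comp U, Category.assoc]

lemma flat_comp_right {Q V V' : N} (g : Q ⟶ U.obj (R.obj V)) (h : V ⟶ V') :
    flat adjLU adjUR (g ≫ umap U (umap R h)) = flat adjLU adjUR g ≫ h := by
  dsimp only [flat]
  rw [umap_comp L, Category.assoc, adjLU.ε_naturality, ← Category.assoc, umap_comp U,
    Category.assoc, adjUR.ε_naturality, Category.assoc]

lemma flat_injective {Q V : N} {g h : Q ⟶ U.obj (R.obj V)}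
    (e : flat adjLU adjUR g = flat adjLU adjUR h) : g = h := by
  rw [← sharp_flat adjLU adjUR g, e, sharp_flat]

/-- The counit component of a map into `U R V` is the restriction of its transpose along the unit.
Prescribing this component together with the restriction along `P ⟶ Q` thus means prescribing the
transpose on the pushout of `U L P` and `Q` over `P`. -/
lemma η_flat {Q V : N} (g : Q ⟶ U.obj (R.obj V)) :
    adjLU.η Q ≫ flat adjLU adjUR g = g ≫ adjUR.ε V := by
  dsimp only [flat]
  rw [umap_comp U, Category.assoc, ← adjLU.η_naturality_assoc, adjLU.right_triangle_assoc]

end Transpose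

/-! ### Consequences of the Quillen cofibration hypothesis -/

section QuillenCofibration

variable {M : Type u₁} [Category.{v} M] [SimplicialCategory M]
variable {N : Type u₂} [Category.{v} N] [SimplicialCategory N] [ModelCategory N]
variable {U : EnrichedFunctor SSet.{v} M N} {L R : EnrichedFunctor SSet.{v} N M}
  (adjLU : SimplicialAdjunction L U) (adjUR : SimplicialAdjunction U R)

lemma trivialCofibrations_pushout_unit (hunit : IsQuillenCofibration adjLU.adj.unit)
    {A B : N} (i : A ⟶ B) (hi : trivialCofibrations N i) :
    trivialCofibrations N
      (pushout.desc (umap U (umap L i)) (adjLU.η B) (adjLU.η_naturality i).symm :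
        pushout (adjLU.η A) i ⟶ U.obj (L.obj B)) :=
  (hunit i).2 hi

/-- `U L i` is a cobase change of `i` along the unit, followed by the map that the Quillen
cofibration condition makes a trivial cofibration. -/
lemma trivialCofibrations_umap_umap (hunit : IsQuillenCofibration adjLU.adj.unit)
    {A B : N} (i : A ⟶ B) (hi : trivialCofibrations N i) :
    trivialCofibrations N (umap U (umap L i)) := by
  have h := (trivialCofibrations N).comp_mem (pushout.inl (adjLU.η A) i) _
    ((trivialCofibrations N).of_isPushout (IsPushout.of_hasPushout (adjLU.η A) i) hi)
    (trivialCofibrations_pushout_unit adjLU hunit i hi)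
  rwa [pushout.inl_desc] at h

include adjLU in
/-- Injective fibrations are `U`-fibrations. -/
lemma UFibrations_of_injectiveFibrations (hunit : IsQuillenCofibration adjLU.adj.unit)
    {X Y : M} (f : X ⟶ Y) (hf : injectiveFibrations (underlying U) f) :
    UFibrations (underlying U) f := by
  change fibrations N ((underlying U).map f)
  rw [← trivialCofibrations_rlp]
  intro A B i hi
  have := hf _ (trivialCofibrations_umap_umap adjLU hunit i hi)
  exact (adjLU.adj.hasLiftingProperty_iff i f).1 this

/-- Transposition reduces lifting problems against `U R V ⟶ U R W` with prescribed counit component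
to lifting problems against `V ⟶ W`. -/
lemma exists_transposed_lifting_problem (hunit : IsQuillenCofibration adjLU.adj.unit)
    {P Q V W : N} (j : P ⟶ Q) (hj : trivialCofibrations N j) (p : V ⟶ W)
    (a : P ⟶ U.obj (R.obj V)) (b : Q ⟶ U.obj (R.obj W)) (y : Q ⟶ V)
    (hab : a ≫ umap U (umap R p) = j ≫ b) (hya : j ≫ y = a ≫ adjUR.ε V)
    (hyb : y ≫ p = b ≫ adjUR.ε W) :
    ∃ (P' : N) (k : P' ⟶ U.obj (L.obj Q)) (a' : P' ⟶ V), trivialCofibrations N k ∧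
      a' ≫ p = k ≫ flat adjLU adjUR b ∧
      (∀ c : U.obj (L.obj Q) ⟶ V, k ≫ c = a' →
        j ≫ sharp adjLU adjUR c = a ∧ sharp adjLU adjUR c ≫ adjUR.ε V = y) ∧
      (∀ ⦃V' : N⦄ (g : U.obj (L.obj Q) ⟶ V') (d : V ⟶ V'),
        umap U (umap L j) ≫ g = flat adjLU adjUR a ≫ d → adjLU.η Q ≫ g = y ≫ d →
          k ≫ g = a' ≫ d) := by
  refine ⟨pushout (adjLU.η P) j, _,
    pushout.desc (flat adjLU adjUR a) y (by rw [η_flat, hya]),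
    trivialCofibrations_pushout_unit adjLU hunit j hj, ?_, ?_, ?_⟩
  · apply pushout.hom_ext
    · rw [pushout.inl_desc_assoc, pushout.inl_desc_assoc, ← flat_comp_left, ← flat_comp_right, hab]
    · rw [pushout.inr_desc_assoc, pushout.inr_desc_assoc, η_flat, hyb]
  · intro c hc
    constructor
    · apply flat_injective adjLU adjUR
      have := pushout.inl _ _ ≫= hc
      rw [pushout.inl_desc_assoc, pushout.inl_desc] at this
      rw [flat_comp_left, flat_sharp, this]
    · have := pushout.inr _ _ ≫= hc
      rw [pushout.inr_desc_assoc, pushout.inr_desc] at this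
      rw [← η_flat adjLU, flat_sharp, this]
  · intro V' g d h₁ h₂
    apply pushout.hom_ext
    · rw [pushout.inl_desc_assoc, pushout.inl_desc_assoc, h₁]
    · rw [pushout.inr_desc_assoc, pushout.inr_desc_assoc, h₂]

end QuillenCofibration

/-! ### Relative matching maps of the iterates `U (R U)ⁿ f` -/

section Matching

variable {M : Type u₁} [Category.{v} M] [SimplicialCategory M]
variable {N : Type u₂} [Category.{v} N] [SimplicialCategory N]
variable {U : EnrichedFunctor SSet.{v} M N} {L R : EnrichedFunctor SSet.{v} N M}
  (adjLU : SimplicialAdjunction L U) (adjUR : SimplicialAdjunction U R)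

/-- The object `(R U)ⁿ X`. -/
def iterObj (n : ℕ) (X : M) : M := (iter adjUR.adj.toMonad n).obj X

/-- The functoriality of `(R U)ⁿ X`. -/
def iterMap (n : ℕ) {X Y : M} (f : X ⟶ Y) : iterObj adjUR n X ⟶ iterObj adjUR n Y :=
  (iter adjUR.adj.toMonad n).map f

/-- The codegeneracies `U (R U)ⁿ⁺¹ X ⟶ U (R U)ⁿ X`: the `i`-th one is the counit applied after
`i` copies of `U R`. -/
def codeg : ∀ (n _ : ℕ) (X : M), U.obj (iterObj adjUR (n + 1) X) ⟶ U.obj (iterObj adjUR n X)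
  | n, 0, X => adjUR.ε (U.obj (iterObj adjUR n X))
  -- Only indices `i ≤ n` are meaningful; this is a default value.
  | 0, _ + 1, X => adjUR.ε (U.obj (iterObj adjUR 0 X))
  | n + 1, i + 1, X => umap U (umap R (codeg n i X))

lemma codeg_zero (n : ℕ) (X : M) :
    codeg adjUR n 0 X = adjUR.ε (U.obj (iterObj adjUR n X)) := by
  cases n <;> rfl

/-- The cosimplicial identities satisfied by the codegeneracies of a map into `U (R U)ⁿ⁺¹ X`. -/
def MatchingCompatible {Q : N} {X : M} :
    ∀ (n : ℕ) (_ : ℕ → (Q ⟶ U.obj (iterObj adjUR n X))), Prop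
  | 0, _ => True
  | n + 1, y => ∀ i j, i ≤ j → j ≤ n → y (j + 1) ≫ codeg adjUR n i X = y i ≫ codeg adjUR n j X

variable [ModelCategory N]

include adjLU in
/-- The relative matching maps of `[n] ↦ U (R U)ⁿ f` are fibrations, as a lifting property. -/
theorem exists_matching_lift (hunit : IsQuillenCofibration adjLU.adj.unit)
    {X Y : M} (f : X ⟶ Y) (hf : fibrations N (umap U f)) (n : ℕ) :
    ∀ {P Q : N} (j : P ⟶ Q) (_ : trivialCofibrations N j)
      (a : P ⟶ U.obj (iterObj adjUR (n + 1) X)) (b : Q ⟶ U.obj (iterObj adjUR (n + 1) Y))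
      (y : ℕ → (Q ⟶ U.obj (iterObj adjUR n X)))
      (_ : a ≫ umap U (iterMap adjUR (n + 1) f) = j ≫ b)
      (_ : ∀ i ≤ n, j ≫ y i = a ≫ codeg adjUR n i X)
      (_ : ∀ i ≤ n, y i ≫ umap U (iterMap adjUR n f) = b ≫ codeg adjUR n i Y)
      (_ : MatchingCompatible adjUR n y),
      ∃ c : Q ⟶ U.obj (iterObj adjUR (n + 1) X), j ≫ c = a ∧
        c ≫ umap U (iterMap adjUR (n + 1) f) = b ∧ ∀ i ≤ n, c ≫ codeg adjUR n i X = y i := by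
  -- The whole square varies in the induction, since transposition replaces `P ⟶ Q` by another
  -- trivial cofibration.
  induction n with
  | zero =>
    intro P Q j hj a b y hab hya hyb _
    obtain ⟨P', k, a', hk, h₁, h₂, -⟩ := exists_transposed_lifting_problem adjLU adjUR hunit j hj
      (umap U f) a b (y 0) hab (hya 0 le_rfl) (hyb 0 le_rfl)
    have : HasLiftingProperty k (umap U f) := by
      rw [← fibrations_llp] at hk
      exact hk _ hf
    have sq : CommSq a' k (umap U f) (flat adjLU adjUR b) := ⟨h₁⟩
    obtain ⟨h₃, h₄⟩ := h₂ sq.lift sq.fac_left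
    refine ⟨sharp adjLU adjUR sq.lift, h₃, ?_, ?_⟩
    · apply flat_injective adjLU adjUR
      refine (flat_comp_right adjLU adjUR _ (umap U f)).trans ?_
      exact (congrArg (· ≫ umap U f) (flat_sharp adjLU adjUR sq.lift)).trans sq.fac_right
    · intro i hi
      obtain rfl : i = 0 := by lia
      exact h₄
  | succ n ih =>
    intro P Q j hj a b y hab hya hyb hyy
    obtain ⟨P', k, a', hk, h₁, h₂, h₃⟩ := exists_transposed_lifting_problem adjLU adjUR hunit j hj
      (umap U (iterMap adjUR (n + 1) f)) a b (y 0) hab (hya 0 (by lia)) (hyb 0 (by lia))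
    have flat_comp {Q : N} {X : M} (i : ℕ) (g : Q ⟶ U.obj (iterObj adjUR (n + 2) X)) :
        flat adjLU adjUR (g ≫ codeg adjUR (n + 1) (i + 1) X :) =
          (flat adjLU adjUR g ≫ codeg adjUR n i X :) :=
      flat_comp_right adjLU adjUR g _
    -- Codegeneracy `i + 1` is `U R` applied to codegeneracy `i` one dimension lower, so the
    -- conditions of positive index transpose to the same problem for `n`. The condition of index
    -- `0` concerns the counit and has been absorbed into `P'`.
    let y' (i : ℕ) : U.obj (L.obj Q) ⟶ U.obj (iterObj adjUR n X) :=
      flat adjLU adjUR (V := U.obj (iterObj adjUR n X)) (y (i + 1))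
    obtain ⟨c, hc₁, hc₂, hc₃⟩ := ih k hk a' (flat adjLU adjUR b) y' h₁
      (fun i hi => h₃ _ _
        ((flat_comp_left adjLU adjUR j _).symm.trans
          ((congrArg (flat adjLU adjUR) (hya (i + 1) (by lia))).trans (flat_comp i a)))
        -- On the summand `Q` of `P'`, the equation needed is the cosimplicial identity relating `y
        -- (i + 1)` and `y 0`.
        ((η_flat adjLU adjUR _).trans
          ((congrArg (y (i + 1) ≫ ·) (codeg_zero adjUR n X).symm).trans (hyy 0 i (by lia) hi))))
      (fun i hi => (flat_comp_right adjLU adjUR _ _).symm.trans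
        ((congrArg (flat adjLU adjUR) (hyb (i + 1) (by lia))).trans (flat_comp i b)))
      (by
        cases n with
        | zero => trivial
        | succ n =>
          intro i j hij hj
          refine (flat_comp_right adjLU adjUR _ _).symm.trans
            ((congrArg (flat adjLU adjUR) (hyy (i + 1) (j + 1) (by lia) (by lia))).trans
              (flat_comp_right adjLU adjUR _ _)))
    obtain ⟨h₄, h₅⟩ := h₂ c hc₁
    refine ⟨sharp adjLU adjUR c, h₄, ?_, ?_⟩
    · apply flat_injective adjLU adjUR
      refine (flat_comp_right adjLU adjUR _ (umap U (iterMap adjUR (n + 1) f))).trans ?_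
      exact (congrArg (· ≫ umap U (iterMap adjUR (n + 1) f)) (flat_sharp adjLU adjUR c)).trans hc₂
    · intro i hi
      cases i with
      | zero => exact h₅
      | succ i =>
        apply flat_injective adjLU adjUR
        refine (flat_comp i _).trans ?_
        exact (congrArg (· ≫ codeg adjUR n i X) (flat_sharp adjLU adjUR c)).trans
          (hc₃ i (by lia))

end Matching

open Simplicial

/-! ### Maps out of the boundary of a simplex -/

section Boundary

lemma stdSimplex_map_comp {l m n : SimplexCategory} (f : l ⟶ m) (g : m ⟶ n) :
    SSet.stdSimplex.{v}.map (f ≫ g) = SSet.stdSimplex.map f ≫ SSet.stdSimplex.map g :=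
  Functor.map_comp _ _ _

lemma stdSimplex_map_comp_assoc {l m n : SimplexCategory} (f : l ⟶ m) (g : m ⟶ n) {Z : SSet.{v}}
    (h : SSet.stdSimplex.{v}.obj n ⟶ Z) :
    SSet.stdSimplex.{v}.map (f ≫ g) ≫ h = SSet.stdSimplex.map f ≫ SSet.stdSimplex.map g ≫ h := by
  rw [stdSimplex_map_comp, Category.assoc]

lemma stdSimplex_map_id (n : SimplexCategory) :
    SSet.stdSimplex.{v}.map (𝟙 n) = 𝟙 (SSet.stdSimplex.obj n) :=
  CategoryTheory.Functor.map_id _ _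

lemma yonedaEquiv_naturality {X : SSet.{v}} {m n : SimplexCategory} (θ : m ⟶ n)
    (f : SSet.stdSimplex.obj n ⟶ X) :
    X.map θ.op (SSet.yonedaEquiv f) = SSet.yonedaEquiv (SSet.stdSimplex.map θ ≫ f) :=
  uliftYonedaEquiv_naturality _ θ.op

/-- Two maps from a simplicial set agree if they agree on all simplices. -/
lemma sSet_hom_ext {K X : SSet.{v}} {f g : K ⟶ X}
    (h : ∀ (n : SimplexCategory) (t : SSet.stdSimplex.obj n ⟶ K), t ≫ f = t ≫ g) : f = g := by
  ext n x
  have := congrArg SSet.yonedaEquiv (h n.unop (SSet.yonedaEquiv.symm x))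
  rwa [SSet.yonedaEquiv_symm_comp, SSet.yonedaEquiv_symm_comp, Equiv.apply_symm_apply,
    Equiv.apply_symm_apply] at this

/-- Otherwise the inclusion of the image would be a monomorphism between equal ordinals, hence the
identity, and `θ` would be surjective. -/
lemma len_image_lt_of_not_surjective {m n : SimplexCategory} (θ : m ⟶ n)
    (h : ¬ Function.Surjective θ.toOrderHom) : (image θ).len < n.len := by
  apply SimplexCategory.len_lt_of_mono (image.ι θ)
  intro e
  apply h
  rw [← SimplexCategory.epi_iff_surjective]
  have key : ∀ (k : SimplexCategory) (a : m ⟶ k) (i : k ⟶ n) [Epi a] [Mono i], n = k →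
      Epi (a ≫ i) := by
    rintro k a i _ _ rfl
    rw [SimplexCategory.eq_id_of_mono i, Category.comp_id]
    infer_instance
  have := key _ (factorThruImage θ) (image.ι θ) e
  rwa [image.fac] at this

lemma mem_boundary_iff {n : ℕ} {m : SimplexCategory}
    (x : (Δ[n] : SSet.{v}).obj (op m)) :
    x ∈ (SSet.boundary.{v} n).obj (op m) ↔
      ¬ Function.Surjective (SSet.stdSimplex.objEquiv x).toOrderHom := Iff.rfl

/-- A simplex of the boundary is a non-surjective monotone map. It factors through its image, which
has smaller dimension and still lies in the boundary. -/
lemma boundary_hom_ext {n : ℕ} {X : SSet.{v}} {f g : (SSet.boundary.{v} n : SSet.{v}) ⟶ X}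
    (h : ∀ m < n, ∀ t : (Δ[m] : SSet.{v}) ⟶ (SSet.boundary.{v} n : SSet.{v}), t ≫ f = t ≫ g) :
    f = g := by
  apply sSet_hom_ext
  intro m t
  obtain ⟨θ, hθ⟩ := SSet.stdSimplex.{v}.map_surjective (t ≫ (SSet.boundary.{v} n).ι)
  have hns : ¬ Function.Surjective θ.toOrderHom := by
    have := (SSet.yonedaEquiv t).2
    rw [mem_boundary_iff] at this
    have e : (SSet.yonedaEquiv t).1 = SSet.yonedaEquiv (t ≫ (SSet.boundary.{v} n).ι) := rfl
    rwa [e, ← hθ, SSet.yonedaEquiv_map, Equiv.apply_symm_apply] at this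
  have hlt := len_image_lt_of_not_surjective θ hns
  let t' : SSet.stdSimplex.{v}.obj (image θ) ⟶ (SSet.boundary.{v} n : SSet.{v}) :=
    SSet.Subcomplex.lift (SSet.stdSimplex.map (image.ι θ)) (by
      rintro ⟨k⟩ _ ⟨x, rfl⟩
      rw [mem_boundary_iff]
      intro hs
      have hs' : Epi (SSet.stdSimplex.objEquiv x ≫ image.ι θ) :=
        SimplexCategory.epi_iff_surjective.2 hs
      have : Epi (image.ι θ) := epi_of_epi (SSet.stdSimplex.objEquiv x) _
      have := SimplexCategory.len_le_of_epi (image.ι θ)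
      exact absurd hlt (by simpa using this))
  have ht : t = SSet.stdSimplex.map (factorThruImage θ) ≫ t' := by
    rw [← cancel_mono (SSet.boundary.{v} n).ι, Category.assoc, SSet.Subcomplex.lift_ι, ← hθ,
      ← stdSimplex_map_comp, image.fac]
  rw [ht, Category.assoc, Category.assoc, h _ hlt t']

/-- A map out of the boundary of a simplex can be given on simplices of smaller dimension. -/
lemma exists_boundary_desc {n : ℕ} {X : SSet.{v}}
    (G : ∀ (m : SimplexCategory) (_ : m.len < n) (_ : m ⟶ ⦋n⦌), SSet.stdSimplex.{v}.obj m ⟶ X)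
    (hG : ∀ (m m' : SimplexCategory) (hm : m.len < n) (hm' : m'.len < n) (φ : m' ⟶ m)
      (θ : m ⟶ ⦋n⦌), SSet.stdSimplex.map φ ≫ G m hm θ = G m' hm' (φ ≫ θ)) :
    ∃ k : (SSet.boundary.{v} n : SSet.{v}) ⟶ X,
      ∀ (m : SimplexCategory) (hm : m.len < n) (θ : m ⟶ ⦋n⦌)
        (t : SSet.stdSimplex.{v}.obj m ⟶ (SSet.boundary.{v} n : SSet.{v})),
        t ≫ (SSet.boundary.{v} n).ι = SSet.stdSimplex.map θ → t ≫ k = G m hm θ := by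
  -- The value given by `G` does not depend on the chosen factorization: for monic `μ`, a section of
  -- `π` expresses `e` and `μ'` through each other.
  have key₁ : ∀ (j r s : SimplexCategory) (hr : r.len < n) (hs : s.len < n) (e : j ⟶ r)
      (π : j ⟶ s) [Epi π] (μ : r ⟶ ⦋n⦌) (μ' : s ⟶ ⦋n⦌) [Mono μ], e ≫ μ = π ≫ μ' →
        SSet.stdSimplex.map e ≫ G r hr μ = SSet.stdSimplex.map π ≫ G s hs μ' := by
    intro j r s hr hs e π _ μ μ' _ h
    have := isSplitEpi_of_epi π
    have h₁ : section_ π ≫ e ≫ μ = μ' := by rw [h, IsSplitEpi.id_assoc]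
    have h₂ : π ≫ section_ π ≫ e = e := by
      rw [← cancel_mono μ, Category.assoc, Category.assoc, h₁, h]
    conv_lhs => rw [← h₂]
    rw [stdSimplex_map_comp, Category.assoc, hG r s hr hs (section_ π ≫ e) μ, Category.assoc]
    congr 2
  -- For arbitrary `μ`, pass from `r` to the image of `μ`.
  have key₂ : ∀ (j r s : SimplexCategory) (hr : r.len < n) (hs : s.len < n) (e : j ⟶ r)
      (π : j ⟶ s) [Epi π] (μ : r ⟶ ⦋n⦌) (μ' : s ⟶ ⦋n⦌), e ≫ μ = π ≫ μ' →
        SSet.stdSimplex.map e ≫ G r hr μ = SSet.stdSimplex.map π ≫ G s hs μ' := by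
    intro j r s hr hs e π _ μ μ' h
    have hi : (image μ).len < n :=
      (SimplexCategory.len_le_of_epi (factorThruImage μ)).trans_lt hr
    have h₁ := hG _ _ hi hr (factorThruImage μ) (image.ι μ)
    have h₂ := key₁ j (image μ) s hi hs (e ≫ factorThruImage μ) π (image.ι μ) μ'
      (by rw [Category.assoc, image.fac, h])
    rw [← h₂, stdSimplex_map_comp, Category.assoc, h₁]
    congr 2
    exact (image.fac μ).symm
  -- A simplex is sent to the value of `G` on its image, pulled back along the surjection onto that
  -- image.
  let val (j : SimplexCategory) (x : (SSet.boundary.{v} n : SSet.{v}).obj (op j)) :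
      SSet.stdSimplex.{v}.obj j ⟶ X :=
    SSet.stdSimplex.map (factorThruImage (SSet.stdSimplex.objEquiv x.1)) ≫
      G _ (len_image_lt_of_not_surjective _ ((mem_boundary_iff x.1).1 x.2))
        (image.ι (SSet.stdSimplex.objEquiv x.1))
  have hval (j : SimplexCategory) (x : (SSet.boundary.{v} n : SSet.{v}).obj (op j))
      (r : SimplexCategory) (hr : r.len < n) (e : j ⟶ r) (μ : r ⟶ ⦋n⦌)
      (h : e ≫ μ = SSet.stdSimplex.objEquiv x.1) :
      SSet.stdSimplex.map e ≫ G r hr μ = val j x := by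
    apply key₂
    rw [h, image.fac]
  let k : (SSet.boundary.{v} n : SSet.{v}) ⟶ X :=
    { app j := TypeCat.ofHom fun x => SSet.yonedaEquiv (val j.unop x)
      naturality := by
        rintro ⟨j⟩ ⟨j'⟩ φ
        ext x
        change SSet.yonedaEquiv (val j' ((SSet.boundary.{v} n : SSet.{v}).map φ x)) =
          X.map φ.unop.op (SSet.yonedaEquiv (val j x))
        rw [yonedaEquiv_naturality]
        congr 1
        rw [← hval j' ((SSet.boundary.{v} n : SSet.{v}).map φ x) _
          (len_image_lt_of_not_surjective _ ((mem_boundary_iff x.1).1 x.2))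
          (φ.unop ≫ factorThruImage (SSet.stdSimplex.objEquiv x.1))
          (image.ι (SSet.stdSimplex.objEquiv x.1))
          (by rw [Category.assoc, image.fac]; rfl)]
        rw [stdSimplex_map_comp, Category.assoc] }
  refine ⟨k, fun m hm θ t ht => ?_⟩
  apply SSet.yonedaEquiv.injective
  have e : SSet.yonedaEquiv (t ≫ k) = SSet.yonedaEquiv (val m (SSet.yonedaEquiv t)) := rfl
  rw [e, ← hval m (SSet.yonedaEquiv t) m hm (𝟙 m) θ, stdSimplex_map_id, Category.id_comp]
  have e' : (SSet.yonedaEquiv t).1 = SSet.yonedaEquiv (t ≫ (SSet.boundary.{v} n).ι) := rfl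
  rw [e', ht, SSet.yonedaEquiv_map, Equiv.apply_symm_apply, Category.id_comp]

end Boundary

/-! ### Cosimplicial lifts by induction on the dimension -/

section ReedyInduction

variable {Q W₁ W₂ : SimplexCategory ⥤ SSet.{v}}

/-- A family of maps `Δ[n] ⟶ Q n` that is natural in `[n]`. -/
def IsCosimplicial (Q : SimplexCategory ⥤ SSet.{v})
    (c : ∀ n : SimplexCategory, SSet.stdSimplex.{v}.obj n ⟶ Q.obj n) : Prop :=
  ∀ ⦃m n : SimplexCategory⦄ (θ : m ⟶ n), SSet.stdSimplex.map θ ≫ c n = c m ≫ Q.map θ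

/-- A lift of `(w₁, w₂)` along `(p₁, p₂)`, defined in dimensions less than `N`. -/
structure PartialLift (p₁ : Q ⟶ W₁) (p₂ : Q ⟶ W₂)
    (w₁ : ∀ n : SimplexCategory, SSet.stdSimplex.{v}.obj n ⟶ W₁.obj n)
    (w₂ : ∀ n : SimplexCategory, SSet.stdSimplex.{v}.obj n ⟶ W₂.obj n) (N : ℕ) where
  /-- the components of the lift -/
  map (m : ℕ) (hm : m < N) : SSet.stdSimplex.{v}.obj ⦋m⦌ ⟶ Q.obj ⦋m⦌
  naturality (m n : ℕ) (hm : m < N) (hn : n < N) (θ : ⦋m⦌ ⟶ ⦋n⦌) :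
    SSet.stdSimplex.map θ ≫ map n hn = map m hm ≫ Q.map θ
  fac₁ (m : ℕ) (hm : m < N) : map m hm ≫ p₁.app _ = w₁ _
  fac₂ (m : ℕ) (hm : m < N) : map m hm ≫ p₂.app _ = w₂ _

variable {p₁ : Q ⟶ W₁} {p₂ : Q ⟶ W₂}
  {w₁ : ∀ n : SimplexCategory, SSet.stdSimplex.{v}.obj n ⟶ W₁.obj n}
  {w₂ : ∀ n : SimplexCategory, SSet.stdSimplex.{v}.obj n ⟶ W₂.obj n}

/-- Naturality for a map between dimensions at most `N` only needs new input when source or target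
is `⦋N⦌`; `hl`, `hr` and `he` cover these three cases. -/
lemma PartialLift.exists_extension {N : ℕ} (s : PartialLift p₁ p₂ w₁ w₂ N)
    (c : SSet.stdSimplex.{v}.obj ⦋N⦌ ⟶ Q.obj ⦋N⦌)
    (h₁ : c ≫ p₁.app _ = w₁ _) (h₂ : c ≫ p₂.app _ = w₂ _)
    (hl : ∀ (m : ℕ) (hm : m < N) (θ : ⦋m⦌ ⟶ ⦋N⦌),
      SSet.stdSimplex.map θ ≫ c = s.map m hm ≫ Q.map θ)
    (hr : ∀ (m : ℕ) (hm : m < N) (θ : ⦋N⦌ ⟶ ⦋m⦌),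
      SSet.stdSimplex.map θ ≫ s.map m hm = c ≫ Q.map θ)
    (he : ∀ θ : ⦋N⦌ ⟶ ⦋N⦌, SSet.stdSimplex.map θ ≫ c = c ≫ Q.map θ) :
    ∃ s' : PartialLift p₁ p₂ w₁ w₂ (N + 1),
      ∀ (m : ℕ) (hm : m < N), s'.map m (hm.trans N.lt_succ_self) = s.map m hm := by
  let f (m : ℕ) (hm : m < N + 1) : SSet.stdSimplex.{v}.obj ⦋m⦌ ⟶ Q.obj ⦋m⦌ :=
    if h : m < N then s.map m h
    else Eq.ndrec (motive := fun k => SSet.stdSimplex.{v}.obj ⦋k⦌ ⟶ Q.obj ⦋k⦌) c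
      (by lia : N = m)
  have f_lt (m : ℕ) (hm : m < N + 1) (h : m < N) : f m hm = s.map m h := dif_pos h
  have f_eq (hm : N < N + 1) : f N hm = c := dif_neg (lt_irrefl N)
  refine ⟨⟨f, ?_, ?_, ?_⟩, fun m hm => f_lt m (hm.trans N.lt_succ_self) hm⟩
  · intro m n hm hn θ
    obtain hm' | rfl := Nat.lt_succ_iff_lt_or_eq.1 hm <;>
    obtain hn' | hn' := Nat.lt_succ_iff_lt_or_eq.1 hn
    · rw [f_lt _ hm hm', f_lt _ hn hn', s.naturality]
    · subst hn'
      rw [f_lt _ hm hm', f_eq hn, hl]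
    · rw [f_lt _ hn hn', f_eq hm, hr]
    · subst hn'
      rw [f_eq hm, he]
  · intro m hm
    obtain hm' | rfl := Nat.lt_succ_iff_lt_or_eq.1 hm
    · rw [f_lt _ hm hm', s.fac₁]
    · rw [f_eq hm, h₁]
  · intro m hm
    obtain hm' | rfl := Nat.lt_succ_iff_lt_or_eq.1 hm
    · rw [f_lt _ hm hm', s.fac₂]
    · rw [f_eq hm, h₂]

/-- Each stage restricts to its predecessor, so the component in dimension `m` can be read off at
stage `m + 1`, and naturality can be checked at any stage beyond both dimensions. -/
lemma exists_cosimplicial_of_extensions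
    (h : ∀ (N : ℕ) (s : PartialLift p₁ p₂ w₁ w₂ N), ∃ s' : PartialLift p₁ p₂ w₁ w₂ (N + 1),
      ∀ (m : ℕ) (hm : m < N), s'.map m (hm.trans N.lt_succ_self) = s.map m hm) :
    ∃ c : ∀ n : SimplexCategory, SSet.stdSimplex.{v}.obj n ⟶ Q.obj n, IsCosimplicial Q c ∧
      (∀ n, c n ≫ p₁.app n = w₁ n) ∧ ∀ n, c n ≫ p₂.app n = w₂ n := by
  choose ext hext using h
  let s (N : ℕ) : PartialLift p₁ p₂ w₁ w₂ N :=
    Nat.rec ⟨fun m hm => absurd hm m.not_lt_zero, fun m _ hm => absurd hm m.not_lt_zero,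
      fun m hm => absurd hm m.not_lt_zero, fun m hm => absurd hm m.not_lt_zero⟩ ext N
  have hs (m N : ℕ) (hm : m < N) : (s N).map m hm = (s (m + 1)).map m m.lt_succ_self := by
    induction N with
    | zero => exact absurd hm m.not_lt_zero
    | succ N ih =>
      obtain hm' | rfl := Nat.lt_succ_iff_lt_or_eq.1 hm
      · rw [← ih hm']
        exact hext N (s N) m hm'
      · rfl
  refine ⟨fun n => (s (n.len + 1)).map n.len (Nat.lt_succ_self _), ?_, fun n => (s _).fac₁ _ _,
    fun n => (s _).fac₂ _ _⟩
  intro m n θ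
  let N := max (m.len + 1) (n.len + 1)
  beta_reduce
  rw [← hs m.len N (by lia), ← hs n.len N (by lia)]
  exact (s N).naturality m.len n.len _ _ θ

/-- Construction of a cosimplicial lift by induction on the dimension: the values on the boundary
and the images under the codegeneracies are prescribed in each step. -/
theorem exists_cosimplicial_lift (hw₁ : IsCosimplicial W₁ w₁) (hw₂ : IsCosimplicial W₂ w₂)
    (hzero : ∃ c : SSet.stdSimplex.{v}.obj ⦋0⦌ ⟶ Q.obj ⦋0⦌,
      c ≫ p₁.app _ = w₁ _ ∧ c ≫ p₂.app _ = w₂ _)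
    (hsucc : ∀ (n : ℕ) (k : (SSet.boundary.{v} (n + 1) : SSet.{v}) ⟶ Q.obj ⦋n + 1⦌)
      (y : Fin (n + 1) → (SSet.stdSimplex.{v}.obj ⦋n + 1⦌ ⟶ Q.obj ⦋n⦌)),
      k ≫ p₁.app _ = (SSet.boundary.{v} (n + 1)).ι ≫ w₁ _ →
      k ≫ p₂.app _ = (SSet.boundary.{v} (n + 1)).ι ≫ w₂ _ →
      (∀ i, y i ≫ p₁.app _ = w₁ _ ≫ W₁.map (SimplexCategory.σ i)) →
      (∀ i, y i ≫ p₂.app _ = w₂ _ ≫ W₂.map (SimplexCategory.σ i)) →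
      (∀ i, (SSet.boundary.{v} (n + 1)).ι ≫ y i = k ≫ Q.map (SimplexCategory.σ i)) →
      (∀ (m : ℕ) (i j : Fin (n + 1)) (θ θ' : ⦋n⦌ ⟶ ⦋m⦌), m < n →
        SimplexCategory.σ i ≫ θ = SimplexCategory.σ j ≫ θ' → y i ≫ Q.map θ = y j ≫ Q.map θ') →
      ∃ c : SSet.stdSimplex.{v}.obj ⦋n + 1⦌ ⟶ Q.obj ⦋n + 1⦌,
        (SSet.boundary.{v} (n + 1)).ι ≫ c = k ∧ c ≫ p₁.app _ = w₁ _ ∧ c ≫ p₂.app _ = w₂ _ ∧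
        ∀ i, c ≫ Q.map (SimplexCategory.σ i) = y i) :
    ∃ c : ∀ n : SimplexCategory, SSet.stdSimplex.{v}.obj n ⟶ Q.obj n, IsCosimplicial Q c ∧
      (∀ n, c n ≫ p₁.app n = w₁ n) ∧ ∀ n, c n ≫ p₂.app n = w₂ n := by
  apply exists_cosimplicial_of_extensions
  intro N s
  cases N with
  | zero =>
    obtain ⟨c, h₁, h₂⟩ := hzero
    refine s.exists_extension c h₁ h₂ (fun m hm => absurd hm m.not_lt_zero)
      (fun m hm => absurd hm m.not_lt_zero) (fun θ => ?_)
    obtain rfl : θ = 𝟙 _ := SimplexCategory.hom_zero_zero θ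
    rw [stdSimplex_map_id, Category.id_comp, CategoryTheory.Functor.map_id, Category.comp_id]
  | succ n =>
    -- Naturality for maps from smaller ordinals into `⦋n + 1⦌` forces the values on the boundary.
    obtain ⟨k, hk⟩ := exists_boundary_desc (n := n + 1) (X := Q.obj ⦋n + 1⦌)
      (fun m hm θ => s.map m.len hm ≫ Q.map θ)
      (fun m m' hm hm' φ θ => by
        rw [← Category.assoc]
        refine (congrArg (· ≫ Q.map θ) (s.naturality m'.len m.len hm' hm φ)).trans ?_
        rw [Category.assoc, ← Functor.map_comp])
    have hn : n < n + 1 := n.lt_succ_self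
    have hbd {Z : SSet.{v}} {a b : (SSet.boundary.{v} (n + 1) : SSet.{v}) ⟶ Z}
        (h : ∀ (m : ℕ) (_ : m < n + 1) (θ : ⦋m⦌ ⟶ ⦋n + 1⦌)
          (t : SSet.stdSimplex.{v}.obj ⦋m⦌ ⟶ (SSet.boundary.{v} (n + 1) : SSet.{v})),
          t ≫ (SSet.boundary.{v} (n + 1)).ι = SSet.stdSimplex.map θ → t ≫ a = t ≫ b) : a = b := by
      apply boundary_hom_ext
      intro m hm t
      obtain ⟨θ, hθ⟩ := SSet.stdSimplex.{v}.map_surjective (t ≫ (SSet.boundary.{v} (n + 1)).ι)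
      exact h m hm θ t hθ.symm
    -- Naturality for the codegeneracies forces the composites `y i`.
    obtain ⟨c, hc₀, hc₁, hc₂, hcy⟩ := hsucc n k
      (fun i => SSet.stdSimplex.map (SimplexCategory.σ i) ≫ s.map n hn)
      (hbd fun m hm θ t ht => by
        rw [← Category.assoc, hk ⦋m⦌ hm θ t ht, Category.assoc, NatTrans.naturality,
          ← Category.assoc, ← Category.assoc, ht, hw₁]
        exact congrArg (· ≫ W₁.map θ) (s.fac₁ m hm))
      (hbd fun m hm θ t ht => by
        rw [← Category.assoc, hk ⦋m⦌ hm θ t ht, Category.assoc, NatTrans.naturality,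
          ← Category.assoc, ← Category.assoc, ht, hw₂]
        exact congrArg (· ≫ W₂.map θ) (s.fac₂ m hm))
      (fun i => by rw [Category.assoc, s.fac₁, hw₁])
      (fun i => by rw [Category.assoc, s.fac₂, hw₂])
      (fun i => hbd fun m hm θ t ht => by
        rw [← Category.assoc, ← Category.assoc, ht, ← Category.assoc, hk ⦋m⦌ hm θ t ht,
          ← stdSimplex_map_comp, s.naturality m n hm hn, Functor.map_comp, Category.assoc])
      (fun m i j θ θ' hm h => by
        rw [Category.assoc, Category.assoc, ← s.naturality n m hn (by lia),
          ← s.naturality n m hn (by lia), ← stdSimplex_map_comp_assoc, h,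
          stdSimplex_map_comp_assoc])
    -- A map from a smaller ordinal is not surjective, so it defines a simplex of the boundary,
    -- where `c` is already known.
    have hl (m : ℕ) (hm : m < n + 1) (θ : ⦋m⦌ ⟶ ⦋n + 1⦌) :
        SSet.stdSimplex.map θ ≫ c = s.map m hm ≫ Q.map θ := by
      have hθ : ¬ Function.Surjective θ.toOrderHom := by
        rw [← SimplexCategory.epi_iff_surjective]
        intro h
        have := SimplexCategory.le_of_epi θ
        lia
      let t : SSet.stdSimplex.{v}.obj ⦋m⦌ ⟶ (SSet.boundary.{v} (n + 1) : SSet.{v}) :=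
        SSet.Subcomplex.lift (SSet.stdSimplex.map θ) (by
          rintro ⟨k⟩ _ ⟨x, rfl⟩
          rw [mem_boundary_iff]
          exact fun h => hθ (Function.Surjective.of_comp (g := SSet.stdSimplex.asOrderHom x) h))
      have ht : t ≫ (SSet.boundary.{v} (n + 1)).ι = SSet.stdSimplex.map θ :=
        SSet.Subcomplex.lift_ι _ _
      rw [← ht, Category.assoc, hc₀, hk ⦋m⦌ hm θ t ht]
    have hni {k : SimplexCategory} (θ : ⦋n + 1⦌ ⟶ k)
        (hθ : ¬ Function.Injective θ.toOrderHom) :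
        ∃ (i : Fin (n + 1)) (θ' : ⦋n⦌ ⟶ k), θ = SimplexCategory.σ i ≫ θ' :=
      SimplexCategory.eq_σ_comp_of_not_injective θ hθ
    refine s.exists_extension c hc₁ hc₂ hl ?_ ?_
    · intro m hm θ
      obtain ⟨i, θ', rfl⟩ := hni θ (by
        rw [← SimplexCategory.mono_iff_injective]
        intro h
        have := SimplexCategory.le_of_mono θ
        lia)
      rw [stdSimplex_map_comp_assoc, s.naturality n m hn hm, Functor.map_comp,
        ← Category.assoc c, hcy, Category.assoc]
    -- An injective endomorphism is the identity. Any other one factors through a codegeneracy,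
    -- where `hcy` and `hl` apply.
    · intro θ
      by_cases hθ : Function.Injective θ.toOrderHom
      · have : Mono θ := SimplexCategory.mono_iff_injective.2 hθ
        rw [SimplexCategory.eq_id_of_mono θ, stdSimplex_map_id, Category.id_comp,
          CategoryTheory.Functor.map_id, Category.comp_id]
      · obtain ⟨i, θ', rfl⟩ := hni θ hθ
        rw [stdSimplex_map_comp_assoc, hl n hn, Functor.map_comp,
          ← Category.assoc c, hcy, Category.assoc]

end ReedyInduction

/-! ### The simplicial universal property of the totalization -/

section TotUniversal

variable {C : Type u} [Category.{v} C] [SimplicialCategory C] [HasCotensors C] [HasLimits C]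

/-- The projection of the totalization to `(Z n) ^ Δ[n]`. -/
def totπ (Z : CosimplicialObject C) (n : SimplexCategory) :
    tot Z ⟶ cotensor (SSet.stdSimplex.{v}.obj n) (Z.obj n) :=
  end_.π (totBifunctor Z) n

lemma totπ_condition (Z : CosimplicialObject C) {m n : SimplexCategory} (θ : m ⟶ n) :
    totπ Z m ≫ cotensorMap (𝟙 _) (Z.map θ) =
      totπ Z n ≫ cotensorMap (SSet.stdSimplex.{v}.map θ) (𝟙 (Z.obj n)) :=
  end_.condition (totBifunctor Z) θ

/-- The universal map `Δ[n] ⟶ Map(tot Z, Z n)`. -/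
def totEv (Z : CosimplicialObject C) (n : SimplexCategory) :
    SSet.stdSimplex.{v}.obj n ⟶ (tot Z ⟶[SSet.{v}] Z.obj n) :=
  cotensorEv _ _ ≫ eHomWhiskerRight SSet.{v} (totπ Z n) (Z.obj n)

lemma totEv_naturality (Z : CosimplicialObject C) {m n : SimplexCategory} (θ : m ⟶ n) :
    SSet.stdSimplex.map θ ≫ totEv Z n = totEv Z m ≫ eHomWhiskerLeft SSet.{v} _ (Z.map θ) := by
  have h := congrArg (fun g => cotensorEv _ _ ≫ eHomWhiskerRight SSet.{v} g (Z.obj n))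
    (totπ_condition Z θ)
  rw [eHomWhiskerRight_comp, eHomWhiskerRight_comp, cotensorMap_fac_assoc, cotensorMap_fac_assoc,
    eHom_whisker_exchange, eHomWhiskerLeft_id, Category.id_comp, Category.id_comp] at h
  dsimp only [totEv]
  rw [Category.assoc, h]

lemma totEv_naturality_assoc (Z : CosimplicialObject C) {m n : SimplexCategory} (θ : m ⟶ n)
    {K : SSet.{v}} (h : (tot Z ⟶[SSet.{v}] Z.obj n) ⟶ K) :
    SSet.stdSimplex.map θ ≫ totEv Z n ≫ h =
      totEv Z m ≫ eHomWhiskerLeft SSet.{v} _ (Z.map θ) ≫ h := by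
  rw [← Category.assoc, totEv_naturality, Category.assoc]

lemma tot_hom_ext {Z : CosimplicialObject C} {A : C} {f g : A ⟶ tot Z}
    (h : ∀ n, totEv Z n ≫ eHomWhiskerRight SSet.{v} f _ =
      totEv Z n ≫ eHomWhiskerRight SSet.{v} g _) : f = g := by
  apply end_.hom_ext
  intro n
  change f ≫ totπ Z n = g ≫ totπ Z n
  apply cotensor_hom_ext
  rw [eHomWhiskerRight_comp, eHomWhiskerRight_comp]
  simpa only [totEv, Category.assoc] using h n

lemma exists_totLift (Z : CosimplicialObject C) {A : C}
    (e : ∀ n : SimplexCategory, SSet.stdSimplex.{v}.obj n ⟶ (A ⟶[SSet.{v}] Z.obj n))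
    (he : ∀ ⦃m n : SimplexCategory⦄ (θ : m ⟶ n),
      SSet.stdSimplex.map θ ≫ e n = e m ≫ eHomWhiskerLeft SSet.{v} A (Z.map θ)) :
    ∃ g : A ⟶ tot Z, ∀ n, totEv Z n ≫ eHomWhiskerRight SSet.{v} g _ = e n := by
  let g : A ⟶ tot Z := end_.lift (F := totBifunctor Z) (fun n => cotensorLift (e n))
    (fun m n θ => by
      change cotensorLift (e m) ≫ cotensorMap (𝟙 _) (Z.map θ) =
        cotensorLift (e n) ≫ cotensorMap (SSet.stdSimplex.{v}.map θ) (𝟙 (Z.obj n))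
      rw [cotensorLift_comp_map, cotensorLift_comp_map, Category.id_comp, eHomWhiskerLeft_id,
        Category.comp_id, he])
  have hg (n : SimplexCategory) : g ≫ totπ Z n = cotensorLift (e n) := end_.lift_π _ _ n
  refine ⟨g, fun n => ?_⟩
  rw [totEv, Category.assoc, ← eHomWhiskerRight_comp, hg, cotensorLift_fac]

lemma totEv_totMap {Z W : CosimplicialObject C} (φ : Z ⟶ W) (n : SimplexCategory) :
    totEv W n ≫ eHomWhiskerRight SSet.{v} (totMap φ) _ =
      totEv Z n ≫ eHomWhiskerLeft SSet.{v} _ (φ.app n) := by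
  have h : totMap φ ≫ totπ W n = totπ Z n ≫ cotensorMap (𝟙 _) (φ.app n) := end_.map_π _ n
  dsimp only [totEv]
  rw [Category.assoc, ← eHomWhiskerRight_comp, h, eHomWhiskerRight_comp, cotensorMap_fac_assoc,
    eHom_whisker_exchange, Category.id_comp, Category.assoc]

lemma totEv_totMap_assoc {Z W : CosimplicialObject C} (φ : Z ⟶ W) (n : SimplexCategory)
    {K : SSet.{v}} (h : (tot Z ⟶[SSet.{v}] W.obj n) ⟶ K) :
    totEv W n ≫ eHomWhiskerRight SSet.{v} (totMap φ) _ ≫ h =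
      totEv Z n ≫ eHomWhiskerLeft SSet.{v} _ (φ.app n) ≫ h := by
  rw [← Category.assoc, totEv_totMap, Category.assoc]

lemma totEv_cobarUnit (T : Monad C) (X : C) (n : SimplexCategory) :
    totEv ((cobarCosimplicial T).obj X) n ≫ eHomWhiskerRight SSet.{v} (cobarUnit T X) _ =
      constHom _ ((coaugmentation T n).app X) := by
  have h : cobarUnit T X ≫ totπ ((cobarCosimplicial T).obj X) n =
      constMap (SSet.stdSimplex.{v}.obj n) ((coaugmentation T n).app X) := end_.lift_π _ _ n
  refine (Category.assoc _ _ _).trans ?_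
  refine (congrArg (cotensorEv _ _ ≫ ·) (eHomWhiskerRight_comp _ _ _ _).symm).trans ?_
  refine (congrArg (fun g => cotensorEv _ _ ≫ eHomWhiskerRight SSet.{v} g _) h).trans ?_
  exact cotensorLift_fac _

end TotUniversal

/-! ### Codes of the codegeneracies -/

section MonadCodes

variable {C : Type u} [Category.{v} C] (T : Monad C)

/-- The unit inserted by `skip` is multiplied into the outer `T` by `hit`, and a unit law cancels
the two. -/
lemma act_hit_skip_app {m n : ℕ} (g : MonoCode m n) (X : C) :
    (act T g.skip.hit).app X = T.map ((act T g).app X) := by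
  rw [act_hit_app, act_skip_app]
  refine (congrArg (· ≫ T.μ.app _) (T.map_comp _ _)).trans ((Category.assoc _ _ _).trans ?_)
  exact (congrArg (T.map ((act T g).app X) ≫ ·) (T.right_unit ((iter T n).obj X))).trans
    (Category.comp_id _)

/-- The code of the `i`-th codegeneracy. -/
def MonoCode.sigma (n i : ℕ) : MonoCode (n + 2) (n + 1) :=
  match n, i with
  | n, 0 => .hit (.hit (.skip (MonoCode.idCode n)))
  -- A default value: the index is meant to be at most `n`.
  | 0, _ + 1 => .hit (.hit (.skip (MonoCode.idCode 0)))
  | n + 1, i + 1 => .hit (.skip (MonoCode.sigma n i))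

lemma MonoCode.sigma_zero (n : ℕ) :
    MonoCode.sigma n 0 = .hit (.hit (.skip (MonoCode.idCode n))) := by
  cases n <;> rfl

/-- This is the formula for `Fin.predAbove`, by which the code is recognized as that of
`SimplexCategory.σ`. -/
lemma MonoCode.val_toFun_sigma (n i : ℕ) (hi : i ≤ n) (x : Fin (n + 2)) :
    ((MonoCode.sigma n i).toFun x).val = if x.val ≤ i then x.val else x.val - 1 := by
  induction n generalizing i with
  | zero =>
    obtain rfl : i = 0 := by lia
    rw [sigma_zero]
    induction x using Fin.cases with
    | zero => rfl
    | succ x =>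
      induction x using Fin.cases with
      | zero => rfl
      | succ x => exact x.elim0
  | succ n ih =>
    cases i with
    | zero =>
      rw [sigma_zero]
      induction x using Fin.cases with
      | zero => rfl
      | succ x =>
        induction x using Fin.cases with
        | zero => rfl
        | succ x =>
          simp [toFun, toFun_idCode]
    | succ i =>
      induction x using Fin.cases with
      | zero => rfl
      | succ x =>
        have : (MonoCode.sigma (n + 1) (i + 1)).toFun x.succ =
          ((MonoCode.sigma n i).toFun x).succ := rfl
        rw [this, Fin.val_succ, Fin.val_succ, ih i (by lia)]
        split_ifs <;> lia

lemma MonoCode.ofOrderHom_σ (n : ℕ) (i : Fin (n + 1)) :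
    MonoCode.ofOrderHom (SimplexCategory.σ i).toOrderHom = MonoCode.sigma n i := by
  apply MonoCode.toFun_injective
  rw [MonoCode.toFun_ofOrderHom]
  funext x
  apply Fin.ext
  rw [MonoCode.val_toFun_sigma n i (by lia)]
  change (Fin.predAbove i x).val = _
  rw [Fin.predAbove]
  split_ifs with h₁ h₂ h₂
  · simp only [Fin.lt_def, Fin.val_castSucc] at h₁
    lia
  · simp
  · simp
  · simp only [Fin.lt_def, Fin.val_castSucc] at h₁
    lia

end MonadCodes

/-! ### Codegeneracies of the cobar construction -/

section Cobar

variable {M : Type u₁} [Category.{v} M] [SimplicialCategory M]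
variable {N : Type u₂} [Category.{v} N] [SimplicialCategory N]
variable {U : EnrichedFunctor SSet.{v} M N} {R : EnrichedFunctor SSet.{v} N M}
  (adjUR : SimplicialAdjunction U R)

/-- The multiplication of the monad is `R ε U`, which settles index `0`. For larger indices the code
adds an outer `hit` and `skip`, which by `act_hit_skip_app` applies `R U` to the previous case. -/
lemma act_sigma_app (n i : ℕ) (X : M) :
    (act adjUR.adj.toMonad (MonoCode.sigma n i)).app X = umap R (codeg adjUR n i X) := by
  have h0 (n : ℕ) : (act adjUR.adj.toMonad (MonoCode.sigma n 0)).app X =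
      umap R (codeg adjUR n 0 X) := by
    rw [MonoCode.sigma_zero, codeg_zero, act_hit_app]
    refine (congrArg (· ≫ adjUR.adj.toMonad.μ.app _) (congrArg adjUR.adj.toMonad.map ?_)).trans
      ((congrArg (· ≫ adjUR.adj.toMonad.μ.app _) (adjUR.adj.toMonad.map_id _)).trans
        (Category.id_comp _))
    exact congrArg (fun α => α.app X) (act_idCode adjUR.adj.toMonad (n + 1))
  induction n generalizing i with
  | zero =>
    cases i with
    | zero => exact h0 0
    | succ i => exact h0 0
  | succ n ih =>
    cases i with
    | zero => exact h0 _
    | succ i =>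
      refine (act_hit_skip_app _ _ _).trans ?_
      exact congrArg (fun g => umap R (umap U g)) (ih i)

lemma cobarCosimplicial_map_σ (n : ℕ) (i : Fin (n + 1)) (X : M) :
    ((cobarCosimplicial adjUR.adj.toMonad).obj X).map (SimplexCategory.σ i) =
      umap R (codeg adjUR n i X) := by
  refine Eq.trans ?_ (act_sigma_app adjUR n i X)
  exact congrArg (fun c => (act adjUR.adj.toMonad c).app X) (MonoCode.ofOrderHom_σ n i)

end Cobar

/-! ### Simplicial transposition along `U ⊣ R` -/

section SimplicialTranspose

variable {M : Type u₁} [Category.{v} M] [SimplicialCategory M]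
variable {N : Type u₂} [Category.{v} N] [SimplicialCategory N] [HasTensors N]
variable {U : EnrichedFunctor SSet.{v} M N} {R : EnrichedFunctor SSet.{v} N M}
  (adjUR : SimplicialAdjunction U R)

/-- The map `K ⊗ U B ⟶ V` corresponding to `K ⟶ Map(B, R V)`. -/
def transpose {K : SSet.{v}} {B : M} {V : N} (g : K ⟶ (B ⟶[SSet.{v}] R.obj V)) :
    tensor K (U.obj B) ⟶ V :=
  tensorDesc (g ≫ adjUR.toLeft B V)

lemma transpose_injective {K : SSet.{v}} {B : M} {V : N} {g h : K ⟶ (B ⟶[SSet.{v}] R.obj V)}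
    (e : transpose adjUR g = transpose adjUR h) : g = h := by
  rw [← cancel_mono (adjUR.toLeft B V)]
  exact tensorDesc_injective e

lemma transpose_surjective {K : SSet.{v}} {B : M} {V : N} (f : tensor K (U.obj B) ⟶ V) :
    ∃ g : K ⟶ (B ⟶[SSet.{v}] R.obj V), transpose adjUR g = f := by
  refine ⟨tensorCoev _ _ ≫ eHomWhiskerLeft SSet.{v} _ f ≫ adjUR.toRight B V, ?_⟩
  rw [transpose, Category.assoc, Category.assoc, adjUR.toRight_toLeft, Category.comp_id,
    tensorDesc_coev]

lemma transpose_comp {K L : SSet.{v}} (l : K ⟶ L) {B : M} {V : N}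
    (g : L ⟶ (B ⟶[SSet.{v}] R.obj V)) :
    transpose adjUR (l ≫ g) = tensorMap l (𝟙 _) ≫ transpose adjUR g := by
  rw [transpose, transpose, tensorMap_desc, eHomWhiskerRight_id, Category.comp_id, Category.assoc]

lemma transpose_whiskerRight {K : SSet.{v}} {A B : M} (i : A ⟶ B) {V : N}
    (g : K ⟶ (B ⟶[SSet.{v}] R.obj V)) :
    transpose adjUR (g ≫ eHomWhiskerRight SSet.{v} i _) =
      tensorMap (𝟙 K) (umap U i) ≫ transpose adjUR g := by
  rw [transpose, transpose, tensorMap_desc, Category.id_comp, Category.assoc, Category.assoc,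
    adjUR.toLeft_whiskerRight]

lemma transpose_whiskerLeft {K : SSet.{v}} {B : M} {V V' : N}
    (g : K ⟶ (B ⟶[SSet.{v}] R.obj V)) (h : V ⟶ V') :
    transpose adjUR (g ≫ eHomWhiskerLeft SSet.{v} _ (umap R h)) = transpose adjUR g ≫ h := by
  rw [transpose, transpose, tensorDesc_comp, Category.assoc, Category.assoc,
    adjUR.toLeft_whiskerLeft]

include adjUR in
/-- Maps from a simplicial set into `Map(B, R V)` are unique if `V` is terminal. -/
lemma sHom_ext_of_isTerminal {K : SSet.{v}} {B : M} {V : N} (hV : IsTerminal V)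
    (g h : K ⟶ (B ⟶[SSet.{v}] R.obj V)) : g = h :=
  transpose_injective adjUR (hV.hom_ext _ _)

end SimplicialTranspose

/-! ### Simplicial lifting against `R p` and against matching maps -/

section InjectiveFibrations

variable {M : Type u₁} [Category.{v} M] [SimplicialCategory M]
variable {N : Type u₂} [Category.{v} N] [SimplicialCategory N] [ModelCategory N]
  [SimplicialModelCategory N]
variable {U : EnrichedFunctor SSet.{v} M N} {L R : EnrichedFunctor SSet.{v} N M}
  (adjLU : SimplicialAdjunction L U) (adjUR : SimplicialAdjunction U R)

/-- Transposition reduces simplicial lifting problems against `R V ⟶ R W` to lifting problems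
of a trivial cofibration against `V ⟶ W`. -/
lemma exists_transposed_sHom_lifting_problem {K K' : SSet.{v}} (l : K ⟶ K') [Mono l] {A B : M}
    (i : A ⟶ B) (hi : trivialCofibrations N (umap U i)) {V W : N} (p : V ⟶ W)
    (k : K ⟶ (B ⟶[SSet.{v}] R.obj V)) (a : K' ⟶ (A ⟶[SSet.{v}] R.obj V))
    (b : K' ⟶ (B ⟶[SSet.{v}] R.obj W))
    (hka : l ≫ a = k ≫ eHomWhiskerRight SSet.{v} i _)
    (hkb : k ≫ eHomWhiskerLeft SSet.{v} B (umap R p) = l ≫ b)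
    (hab : a ≫ eHomWhiskerLeft SSet.{v} A (umap R p) = b ≫ eHomWhiskerRight SSet.{v} i _) :
    ∃ (P : N) (j : P ⟶ tensor K' (U.obj B)) (a' : P ⟶ V), trivialCofibrations N j ∧
      a' ≫ p = j ≫ transpose adjUR b ∧
      (∀ c : K' ⟶ (B ⟶[SSet.{v}] R.obj V), j ≫ transpose adjUR c = a' →
        l ≫ c = k ∧ c ≫ eHomWhiskerRight SSet.{v} i _ = a) ∧
      (∀ ⦃V' : N⦄ (g : K' ⟶ (B ⟶[SSet.{v}] R.obj V')) (d : V ⟶ V'),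
        l ≫ g = k ≫ eHomWhiskerLeft SSet.{v} B (umap R d) →
        g ≫ eHomWhiskerRight SSet.{v} i _ = a ≫ eHomWhiskerLeft SSet.{v} A (umap R d) →
          j ≫ transpose adjUR g = a' ≫ d) := by
  have w : tensorMap (𝟙 K) (umap U i) ≫ tensorMap l (𝟙 (U.obj B)) =
      tensorMap l (𝟙 (U.obj A)) ≫ tensorMap (𝟙 K') (umap U i) := by
    rw [tensorMap_comp, tensorMap_comp]
    simp
  -- `P` is the source of the pushout product of `l` and `U i`; the transposes of `k` and `a` agree
  -- where they overlap, by `hka`.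
  refine ⟨pushout _ _, pushout.desc _ _ w,
    pushout.desc (transpose adjUR k) (transpose adjUR a) ?_,
    trivialCofibrations_pushoutProduct l (umap U i) hi w, ?_, ?_, ?_⟩
  · rw [← transpose_comp, ← transpose_whiskerRight, hka]
  · apply pushout.hom_ext
    · rw [pushout.inl_desc_assoc, pushout.inl_desc_assoc, ← transpose_comp,
        ← transpose_whiskerLeft, hkb]
    · rw [pushout.inr_desc_assoc, pushout.inr_desc_assoc, ← transpose_whiskerRight,
        ← transpose_whiskerLeft, hab]
  · intro c hc
    constructor <;> apply transpose_injective adjUR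
    · have := pushout.inl _ _ ≫= hc
      rw [pushout.inl_desc_assoc, pushout.inl_desc] at this
      rw [transpose_comp, this]
    · have := pushout.inr _ _ ≫= hc
      rw [pushout.inr_desc_assoc, pushout.inr_desc] at this
      rw [transpose_whiskerRight, this]
  · intro V' g d h₁ h₂
    apply pushout.hom_ext
    · rw [pushout.inl_desc_assoc, pushout.inl_desc_assoc, ← transpose_comp,
        ← transpose_whiskerLeft, h₁]
    · rw [pushout.inr_desc_assoc, pushout.inr_desc_assoc, ← transpose_whiskerRight,
        ← transpose_whiskerLeft, h₂]

include adjUR in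
/-- Simplicial lifting against `R p` for a fibration `p`. -/
lemma exists_sHom_lift_right_adjoint {K K' : SSet.{v}} (l : K ⟶ K') [Mono l] {A B : M}
    (i : A ⟶ B) (hi : trivialCofibrations N (umap U i)) {V W : N} (p : V ⟶ W)
    (hp : fibrations N p)
    (k : K ⟶ (B ⟶[SSet.{v}] R.obj V)) (a : K' ⟶ (A ⟶[SSet.{v}] R.obj V))
    (b : K' ⟶ (B ⟶[SSet.{v}] R.obj W))
    (hka : l ≫ a = k ≫ eHomWhiskerRight SSet.{v} i _)
    (hkb : k ≫ eHomWhiskerLeft SSet.{v} B (umap R p) = l ≫ b)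
    (hab : a ≫ eHomWhiskerLeft SSet.{v} A (umap R p) = b ≫ eHomWhiskerRight SSet.{v} i _) :
    ∃ c : K' ⟶ (B ⟶[SSet.{v}] R.obj V), l ≫ c = k ∧ c ≫ eHomWhiskerRight SSet.{v} i _ = a ∧
      c ≫ eHomWhiskerLeft SSet.{v} B (umap R p) = b := by
  obtain ⟨P, j, a', hj, h₁, h₂, -⟩ :=
    exists_transposed_sHom_lifting_problem adjUR l i hi p k a b hka hkb hab
  have : HasLiftingProperty j p := by
    rw [← fibrations_llp] at hj
    exact hj _ hp
  have sq : CommSq a' j p (transpose adjUR b) := ⟨h₁⟩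
  obtain ⟨c, hc⟩ := transpose_surjective adjUR sq.lift
  obtain ⟨h₃, h₄⟩ := h₂ c (by rw [hc, sq.fac_left])
  refine ⟨c, h₃, h₄, transpose_injective adjUR ?_⟩
  rw [transpose_whiskerLeft, hc, sq.fac_right]

include adjLU in
/-- The simplicial lifting property of the relative matching maps of `[n] ↦ (R U)ⁿ⁺¹ f`. -/
lemma exists_sHom_matching_lift (hunit : IsQuillenCofibration adjLU.adj.unit)
    {K K' : SSet.{v}} (l : K ⟶ K') [Mono l] {A B : M}
    (i : A ⟶ B) (hi : trivialCofibrations N (umap U i)) {X Y : M} (f : X ⟶ Y)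
    (hf : fibrations N (umap U f)) (n : ℕ)
    (k : K ⟶ (B ⟶[SSet.{v}] R.obj (U.obj (iterObj adjUR (n + 1) X))))
    (a : K' ⟶ (A ⟶[SSet.{v}] R.obj (U.obj (iterObj adjUR (n + 1) X))))
    (b : K' ⟶ (B ⟶[SSet.{v}] R.obj (U.obj (iterObj adjUR (n + 1) Y))))
    (y : Fin (n + 1) → (K' ⟶ (B ⟶[SSet.{v}] R.obj (U.obj (iterObj adjUR n X)))))
    (hka : l ≫ a = k ≫ eHomWhiskerRight SSet.{v} i _)
    (hkb : k ≫ eHomWhiskerLeft SSet.{v} B (umap R (umap U (iterMap adjUR (n + 1) f))) = l ≫ b)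
    (hab : a ≫ eHomWhiskerLeft SSet.{v} A (umap R (umap U (iterMap adjUR (n + 1) f))) =
      b ≫ eHomWhiskerRight SSet.{v} i _)
    (hyk : ∀ q : Fin (n + 1),
      l ≫ y q = k ≫ eHomWhiskerLeft SSet.{v} B (umap R (codeg adjUR n q X)))
    (hya : ∀ q : Fin (n + 1), y q ≫ eHomWhiskerRight SSet.{v} i _ =
      a ≫ eHomWhiskerLeft SSet.{v} A (umap R (codeg adjUR n q X)))
    (hyb : ∀ q : Fin (n + 1),
      y q ≫ eHomWhiskerLeft SSet.{v} B (umap R (umap U (iterMap adjUR n f))) =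
        b ≫ eHomWhiskerLeft SSet.{v} B (umap R (codeg adjUR n q Y)))
    -- Identities between codegeneracies out of `y` only make sense for `n = m + 1`; each `eqToHom`
    -- is transport along this equation.
    (hyy : ∀ (m : ℕ) (hm : n = m + 1) (q r : Fin (m + 1)), q ≤ r →
      transpose adjUR (y (Fin.cast (by rw [hm]) r.succ)) ≫ eqToHom (by rw [hm]) ≫
          codeg adjUR m q X =
        transpose adjUR (y (Fin.cast (by rw [hm]) q.castSucc)) ≫ eqToHom (by rw [hm]) ≫
          codeg adjUR m r X) :
    ∃ c : K' ⟶ (B ⟶[SSet.{v}] R.obj (U.obj (iterObj adjUR (n + 1) X))), l ≫ c = k ∧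
      c ≫ eHomWhiskerRight SSet.{v} i _ = a ∧
      c ≫ eHomWhiskerLeft SSet.{v} B (umap R (umap U (iterMap adjUR (n + 1) f))) = b ∧
      ∀ q : Fin (n + 1), c ≫ eHomWhiskerLeft SSet.{v} B (umap R (codeg adjUR n q X)) = y q := by
  obtain ⟨P, j, a', hj, h₁, h₂, h₃⟩ :=
    exists_transposed_sHom_lifting_problem adjUR l i hi _ k a b hka hkb hab
  -- Indices beyond `n` play no role and receive the default `y 0`.
  let y' (q : ℕ) : tensor K' (U.obj B) ⟶ U.obj (iterObj adjUR n X) :=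
    if h : q < n + 1 then transpose adjUR (y ⟨q, h⟩) else transpose adjUR (y 0)
  have hy' (q : ℕ) (h : q < n + 1) : y' q = transpose adjUR (y ⟨q, h⟩) := dif_pos h
  obtain ⟨c', hc₁, hc₂, hc₃⟩ := exists_matching_lift adjLU adjUR hunit f hf n j hj a'
    (transpose adjUR b) y' h₁
    (fun q hq => by
      rw [hy' q (by lia)]
      exact h₃ _ _ (hyk ⟨q, by lia⟩) (hya ⟨q, by lia⟩))
    (fun q hq => by
      rw [hy' q (by lia), ← transpose_whiskerLeft, ← transpose_whiskerLeft, hyb ⟨q, by lia⟩])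
    (by
      cases n with
      | zero => trivial
      | succ n =>
        intro q r hqr hr
        rw [hy' (r + 1) (by lia), hy' q (by lia)]
        have := hyy n rfl ⟨q, by lia⟩ ⟨r, by lia⟩ hqr
        rw [eqToHom_refl, Category.id_comp, Category.id_comp] at this
        exact this)
  obtain ⟨c, hc⟩ := transpose_surjective adjUR c'
  obtain ⟨h₄, h₅⟩ := h₂ c (by rw [hc, hc₁])
  refine ⟨c, h₄, h₅, transpose_injective adjUR ?_, fun q => transpose_injective adjUR ?_⟩
  · rw [transpose_whiskerLeft, hc, hc₂]
  · rw [transpose_whiskerLeft, hc, hc₃ q (by lia), hy' q q.isLt]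

end InjectiveFibrations

/-! ### Components of composites with maps into a totalization -/

section TotComposition

variable {C : Type u} [Category.{v} C] [SimplicialCategory C] [HasCotensors C] [HasLimits C]

lemma totEv_whiskerRight_naturality {Z : CosimplicialObject C} {A : C} (a : A ⟶ tot Z)
    {m n : SimplexCategory} (θ : m ⟶ n) :
    SSet.stdSimplex.map θ ≫ totEv Z n ≫ eHomWhiskerRight SSet.{v} a _ =
      (totEv Z m ≫ eHomWhiskerRight SSet.{v} a _) ≫ eHomWhiskerLeft SSet.{v} A (Z.map θ) := by
  rw [totEv_naturality_assoc, Category.assoc, eHom_whisker_exchange]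

lemma totEv_whiskerRight_comp {Z : CosimplicialObject C} {A B : C} (i : A ⟶ B) (b : B ⟶ tot Z)
    (n : SimplexCategory) :
    totEv Z n ≫ eHomWhiskerRight SSet.{v} (i ≫ b) _ =
      (totEv Z n ≫ eHomWhiskerRight SSet.{v} b _) ≫ eHomWhiskerRight SSet.{v} i _ := by
  rw [eHomWhiskerRight_comp, Category.assoc]

lemma totEv_whiskerRight_comp_totMap {Z W : CosimplicialObject C} (φ : Z ⟶ W) {A : C}
    (a : A ⟶ tot Z) (n : SimplexCategory) :
    totEv W n ≫ eHomWhiskerRight SSet.{v} (a ≫ totMap φ) _ =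
      (totEv Z n ≫ eHomWhiskerRight SSet.{v} a _) ≫
        eHomWhiskerLeft SSet.{v} A (φ.app n) := by
  rw [eHomWhiskerRight_comp, totEv_totMap_assoc, Category.assoc, eHom_whisker_exchange]

end TotComposition

/-! ### Right half of the factorization: injective fibrations -/

section CobarFibrations

variable {M : Type u₁} [Category.{v} M] [SimplicialCategory M] [HasCotensors M] [HasLimits M]
variable {N : Type u₂} [Category.{v} N] [SimplicialCategory N] [ModelCategory N]
  [SimplicialModelCategory N]
variable {U : EnrichedFunctor SSet.{v} M N} {L R : EnrichedFunctor SSet.{v} N M}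
  (adjLU : SimplicialAdjunction L U) (adjUR : SimplicialAdjunction U R)

/-- The cobar construction takes `U`-fibrations to injective fibrations. -/
theorem injectiveFibrations_cobarMap (hunit : IsQuillenCofibration adjLU.adj.unit)
    {X Y : M} (f : X ⟶ Y) (hf : UFibrations (underlying U) f) :
    injectiveFibrations (underlying U) (cobarMap adjUR.adj.toMonad f) := by
  intro A B i hi
  refine ⟨fun {a b} sq => ?_⟩
  let ZX := (cobarCosimplicial adjUR.adj.toMonad).obj X
  let ZY := (cobarCosimplicial adjUR.adj.toMonad).obj Y
  let φ : ZX ⟶ ZY := (cobarCosimplicial adjUR.adj.toMonad).map f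
  let H (A : M) : M ⥤ SSet.{v} := (eHomFunctor SSet.{v} M).obj (op A)
  -- A diagonal `B ⟶ tot ZX` is a natural family of maps from `Δ[n]` to `Map(B, ZX n)`; `p₁` records
  -- its restriction to `A` and `p₂` its image over `ZY`.
  let p₁ : ZX ⋙ H B ⟶ ZX ⋙ H A := Functor.whiskerLeft ZX ((eHomFunctor SSet.{v} M).map i.op)
  let p₂ : ZX ⋙ H B ⟶ ZY ⋙ H B := Functor.whiskerRight φ (H B)
  let w₁ (n : SimplexCategory) : SSet.stdSimplex.{v}.obj n ⟶ (A ⟶[SSet.{v}] ZX.obj n) :=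
    totEv ZX n ≫ eHomWhiskerRight SSet.{v} a _
  let w₂ (n : SimplexCategory) : SSet.stdSimplex.{v}.obj n ⟶ (B ⟶[SSet.{v}] ZY.obj n) :=
    totEv ZY n ≫ eHomWhiskerRight SSet.{v} b _
  have hw (n : SimplexCategory) : w₁ n ≫ eHomWhiskerLeft SSet.{v} A (φ.app n) =
      w₂ n ≫ eHomWhiskerRight SSet.{v} i (ZY.obj n) := by
    refine (totEv_whiskerRight_comp_totMap φ a n).symm.trans (Eq.trans ?_
      (totEv_whiskerRight_comp i b n))
    exact congrArg (fun g => totEv ZY n ≫ eHomWhiskerRight SSet.{v} g _) sq.w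
  obtain ⟨c, hc, hc₁, hc₂⟩ := exists_cosimplicial_lift (Q := ZX ⋙ H B) (W₁ := ZX ⋙ H A)
    (W₂ := ZY ⋙ H B) (p₁ := p₁) (p₂ := p₂) (w₁ := w₁) (w₂ := w₂)
    (fun m n θ => totEv_whiskerRight_naturality a θ)
    (fun m n θ => totEv_whiskerRight_naturality b θ)
    (by
      -- The boundary of `Δ[0]` is empty, so in dimension `0` only lifting against `R U f` remains.
      obtain ⟨k, -⟩ := exists_boundary_desc (n := 0) (X := (B ⟶[SSet.{v}] ZX.obj ⦋0⦌))
        (fun m hm => absurd hm m.len.not_lt_zero) (fun m _ hm => absurd hm m.len.not_lt_zero)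
      have h0 {Z : SSet.{v}} (g h : (SSet.boundary.{v} 0 : SSet.{v}) ⟶ Z) : g = h :=
        boundary_hom_ext fun m hm => absurd hm m.not_lt_zero
      obtain ⟨c, -, h₁, h₂⟩ := exists_sHom_lift_right_adjoint adjUR (SSet.boundary.{v} 0).ι i hi
        (umap U f) hf k (w₁ ⦋0⦌) (w₂ ⦋0⦌) (h0 _ _) (h0 _ _) (hw ⦋0⦌)
      exact ⟨c, h₁, h₂⟩)
    (fun n k y hk₁ hk₂ hy₁ hy₂ hyk hyy => by
      have hσX (q : Fin (n + 1)) : ZX.map (SimplexCategory.σ q) = umap R (codeg adjUR n q X) :=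
        cobarCosimplicial_map_σ adjUR n q X
      have hσY (q : Fin (n + 1)) : ZY.map (SimplexCategory.σ q) = umap R (codeg adjUR n q Y) :=
        cobarCosimplicial_map_σ adjUR n q Y
      obtain ⟨c, h₁, h₂, h₃, h₄⟩ := exists_sHom_matching_lift adjLU adjUR hunit
        (SSet.boundary.{v} (n + 1)).ι i hi f hf n k (w₁ ⦋n + 1⦌) (w₂ ⦋n + 1⦌) y hk₁.symm hk₂
        (hw ⦋n + 1⦌)
        (fun q => (hyk q).trans
          (congrArg (fun g => k ≫ eHomWhiskerLeft SSet.{v} B g) (hσX q)))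
        (fun q => (hy₁ q).trans
          (congrArg (fun g => w₁ ⦋n + 1⦌ ≫ eHomWhiskerLeft SSet.{v} A g) (hσX q)))
        (fun q => (hy₂ q).trans
          (congrArg (fun g => w₂ ⦋n + 1⦌ ≫ eHomWhiskerLeft SSet.{v} B g) (hσY q)))
        (fun m hm q r hqr => by
          subst hm
          have h := hyy m r.succ q.castSucc (SimplexCategory.σ q) (SimplexCategory.σ r)
            m.lt_succ_self (SimplexCategory.σ_comp_σ hqr).symm
          have hs (q : Fin (m + 1)) :
              (ZX ⋙ H B).map (SimplexCategory.σ q) =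
                eHomWhiskerLeft SSet.{v} B (umap R (codeg adjUR m q X)) :=
            congrArg (eHomWhiskerLeft SSet.{v} B) (cobarCosimplicial_map_σ adjUR m q X)
          rw [hs, hs] at h
          rw [eqToHom_refl, Category.id_comp, Category.id_comp]
          refine (transpose_whiskerLeft adjUR _ _).symm.trans
            ((congrArg (transpose adjUR) h).trans (transpose_whiskerLeft adjUR _ _)))
      refine ⟨c, h₁, h₂, h₃, fun q => ?_⟩
      exact (congrArg (fun g => c ≫ eHomWhiskerLeft SSet.{v} B g) (hσX q)).trans (h₄ q))
  obtain ⟨g, hg⟩ := exists_totLift ZX c hc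
  refine ⟨⟨⟨g, tot_hom_ext fun n => ?_, tot_hom_ext fun n => ?_⟩⟩⟩
  · refine (totEv_whiskerRight_comp i g n).trans (Eq.trans ?_ (hc₁ n))
    exact congrArg (· ≫ eHomWhiskerRight SSet.{v} i _) (hg n)
  · refine (totEv_whiskerRight_comp_totMap φ g n).trans (Eq.trans ?_ (hc₂ n))
    exact congrArg (· ≫ eHomWhiskerLeft SSet.{v} _ (φ.app n)) (hg n)

/-- A `U`-fibration whose cobar factorization is split is an injective fibration. -/
theorem injectiveFibrations_of_retraction (hunit : IsQuillenCofibration adjLU.adj.unit)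
    {X Y : M} (f : X ⟶ Y) (hf : UFibrations (underlying U) f)
    (r : cobarFactorization adjUR.adj.toMonad f ⟶ X)
    (hr : cobarLeft adjUR.adj.toMonad f ≫ r = 𝟙 X)
    (hrf : r ≫ f = cobarRight adjUR.adj.toMonad f) :
    injectiveFibrations (underlying U) f := by
  have h : (UTrivialCofibrations (underlying U)).rlp (cobarRight adjUR.adj.toMonad f) :=
    MorphismProperty.of_isPullback (IsPullback.of_hasPullback _ _)
      (injectiveFibrations_cobarMap adjLU adjUR hunit f hf)
  refine MorphismProperty.of_retract (P := (UTrivialCofibrations (underlying U)).rlp)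
    (f := f) (g := cobarRight adjUR.adj.toMonad f) ?_ h
  exact
    { i := Arrow.homMk (cobarLeft adjUR.adj.toMonad f) (𝟙 Y)
        ((cobarLeft_comp_cobarRight _ f).trans (Category.comp_id f).symm)
      r := Arrow.homMk r (𝟙 Y) (hrf.trans (Category.comp_id _).symm)
      retract := by
        ext
        · exact hr
        · exact Category.comp_id _ }

end CobarFibrations

/-! ### The cone on a simplex -/

section ExtraDegeneracy

/-- The morphism of the simplex category with a given code. -/
def MonoCode.hom {m n : SimplexCategory} (c : MonoCode (m.len + 1) (n.len + 1)) : m ⟶ n :=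
  SimplexCategory.Hom.mk ⟨c.toFun, c.monotone_toFun⟩

lemma resolution_map_hom {C : Type u} [Category.{v} C] (T : Monad C) {m n : SimplexCategory}
    (c : MonoCode (m.len + 1) (n.len + 1)) :
    (resolution T).map c.hom = act T c := by
  refine congrArg (act T) (MonoCode.toFun_injective _ _ ?_)
  rw [MonoCode.toFun_ofOrderHom]
  rfl

/-- The map `Δ[1] × Δ[n] ⟶ Δ[n + 1]` which takes `(0, i)` to `0` and `(1, i)` to `i + 1`. -/
def cone (n : SimplexCategory) :
    Δ[1] ⊗ SSet.stdSimplex.{v}.obj n ⟶ SSet.stdSimplex.{v}.obj ⦋n.len + 1⦌ where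
  app d := TypeCat.ofHom fun x => SSet.stdSimplex.objEquiv.symm (SimplexCategory.Hom.mk
    ⟨fun i => if (SSet.stdSimplex.objEquiv x.1).toOrderHom i = 0 then 0 else
      ((SSet.stdSimplex.objEquiv x.2).toOrderHom i).succ, fun i j hij => by
        have h₁ := (SSet.stdSimplex.objEquiv x.1).toOrderHom.monotone hij
        have h₂ := (SSet.stdSimplex.objEquiv x.2).toOrderHom.monotone hij
        dsimp only
        split_ifs with hi hj
        · rfl
        · exact Fin.zero_le _
        · exact absurd (le_antisymm (h₁.trans (by simp_all)) (Fin.zero_le _)) hi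
        · exact Fin.succ_le_succ_iff.2 h₂⟩)
  naturality d d' φ := rfl

/-- The code `skip.hit` of `θ` is the join of `⦋0⦌` with `θ`: it fixes the cone point `0` and acts
as `θ` on the remaining vertices. -/
lemma cone_naturality {m n : SimplexCategory} (θ : m ⟶ n) :
    (Δ[1] ◁ SSet.stdSimplex.{v}.map θ) ≫ cone n = cone m ≫ SSet.stdSimplex.map
      (MonoCode.hom (m := ⦋m.len + 1⦌) (n := ⦋n.len + 1⦌)
        (MonoCode.ofOrderHom θ.toOrderHom).skip.hit) := by
  ext d x
  apply SSet.stdSimplex.objEquiv.injective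
  apply SimplexCategory.Hom.ext
  refine OrderHom.ext _ _ (funext fun i => ?_)
  set α := (SSet.stdSimplex.objEquiv x.2).toOrderHom i
  change (if (SSet.stdSimplex.objEquiv x.1).toOrderHom i = 0 then 0 else
    (θ.toOrderHom α).succ) = (MonoCode.ofOrderHom θ.toOrderHom).skip.hit.toFun
      (if (SSet.stdSimplex.objEquiv x.1).toOrderHom i = 0 then 0 else α.succ)
  split_ifs
  · rfl
  · change _ = ((MonoCode.ofOrderHom θ.toOrderHom).toFun α).succ
    rw [MonoCode.toFun_ofOrderHom]

/-- The vertex `1` of `Δ[1]`. -/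
def vertexOne : 𝟙_ SSet.{v} ⟶ Δ[1] := SSet.const (SSet.stdSimplex.obj₀Equiv.symm 1)

/-- Over the vertex `1`, the cone is the face opposite to the cone point, whose code is `skip` of
the identity. -/
lemma vertexOne_cone (n : SimplexCategory) :
    (vertexOne ▷ SSet.stdSimplex.{v}.obj n) ≫ cone n = (λ_ _).hom ≫ SSet.stdSimplex.map
      (MonoCode.hom (n := ⦋n.len + 1⦌) (MonoCode.idCode (n.len + 1)).skip) := by
  ext d x
  apply SSet.stdSimplex.objEquiv.injective
  apply SimplexCategory.Hom.ext
  refine OrderHom.ext _ _ (funext fun i => ?_)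
  set α := (SSet.stdSimplex.objEquiv x.2).toOrderHom i
  change α.succ = ((MonoCode.idCode (n.len + 1)).toFun α).succ
  rw [MonoCode.toFun_idCode, id]

/-- The horn is the vertex `0` of `Δ[1]`, over which everything collapses to the cone point. -/
lemma horn_cone (n : SimplexCategory) :
    ((SSet.horn.{v} 1 0).ι ▷ SSet.stdSimplex.{v}.obj n) ≫ cone n =
      SSet.stdSimplex.isTerminalObj₀.from _ ≫ SSet.stdSimplex.map
        (MonoCode.hom (m := ⦋0⦌) (n := ⦋n.len + 1⦌) (MonoCode.emptyCode (n.len + 1)).skip.hit) := by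
  ext d x
  apply SSet.stdSimplex.objEquiv.injective
  apply SimplexCategory.Hom.ext
  refine OrderHom.ext _ _ (funext fun i => ?_)
  set β := (SSet.stdSimplex.objEquiv x.1.1).toOrderHom i with hβ
  have h : β = 0 := by
    -- A nonzero value would, together with `0`, exhaust the vertices of `Δ[1]`, which membership in
    -- the horn forbids.
    by_contra h
    refine (SSet.mem_horn_iff 0 x.1.1).1 x.1.2 (Set.eq_univ_of_forall fun j => ?_)
    by_cases hj : j = 0
    · exact Or.inr hj
    · refine Or.inl ⟨i, ?_⟩
      change β = j
      lia
  have h' (k : Fin 1) : 0 = (MonoCode.emptyCode (n.len + 1)).skip.hit.toFun k := by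
    obtain rfl : k = 0 := Subsingleton.elim _ _
    rfl
  exact (if_pos h).trans (h' _)

end ExtraDegeneracy

/-! ### Composition pairings of simplicial hom-sets -/

section Pairing

variable {C : Type u} [Category.{v} C] [SimplicialCategory C]

/-- Associativity of simplicial composition, with the vertex `g` as middle factor. -/
lemma eHomWhiskerLeft_whiskerRight_eComp (X : C) {Y Y' : C} (g : Y ⟶ Y') (Z : C) :
    eHomWhiskerLeft SSet.{v} X g ▷ _ ≫ eComp SSet.{v} X Y' Z =
      _ ◁ eHomWhiskerRight SSet.{v} g Z ≫ eComp SSet.{v} X Y Z := by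
  dsimp only [eHomWhiskerLeft, eHomWhiskerRight]
  simp only [whisker_assoc_symm, triangle_assoc_comp_left_inv_assoc, e_assoc', Category.assoc,
    MonoidalCategory.whiskerLeft_comp, comp_whiskerRight]

/-- The composition `K ⊗ L ⟶ Map(X, Z)` of `K ⟶ Map(X, Y)` and `L ⟶ Map(Y, Z)`. -/
def pairing {K L : SSet.{v}} {X Y Z : C} (h : K ⟶ (X ⟶[SSet.{v}] Y)) (e : L ⟶ (Y ⟶[SSet.{v}] Z)) :
    K ⊗ L ⟶ (X ⟶[SSet.{v}] Z) :=
  (h ⊗ₘ e) ≫ eComp SSet.{v} X Y Z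

variable {K K' L L' : SSet.{v}} {X X' Y Y' Z Z' : C}

lemma comp_pairing (k : K ⟶ K') (h : K' ⟶ (X ⟶[SSet.{v}] Y)) (e : L ⟶ (Y ⟶[SSet.{v}] Z)) :
    pairing (k ≫ h) e = (k ▷ L) ≫ pairing h e := by
  simp [pairing, MonoidalCategory.tensorHom_def]

lemma pairing_comp (h : K ⟶ (X ⟶[SSet.{v}] Y)) (l : L ⟶ L') (e : L' ⟶ (Y ⟶[SSet.{v}] Z)) :
    pairing h (l ≫ e) = (K ◁ l) ≫ pairing h e := by
  simp [pairing, MonoidalCategory.tensorHom_def']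

lemma pairing_whiskerLeft (h : K ⟶ (X ⟶[SSet.{v}] Y)) (e : L ⟶ (Y ⟶[SSet.{v}] Z)) (g : Z ⟶ Z') :
    pairing h (e ≫ eHomWhiskerLeft SSet.{v} Y g) =
      pairing h e ≫ eHomWhiskerLeft SSet.{v} X g := by
  rw [pairing, pairing, Category.assoc, eComp_eHomWhiskerLeft, MonoidalCategory.tensorHom_def,
    MonoidalCategory.tensorHom_def, MonoidalCategory.whiskerLeft_comp]
  simp only [Category.assoc]

lemma pairing_whiskerRight (f : X' ⟶ X) (h : K ⟶ (X ⟶[SSet.{v}] Y))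
    (e : L ⟶ (Y ⟶[SSet.{v}] Z)) :
    pairing (h ≫ eHomWhiskerRight SSet.{v} f Y) e =
      pairing h e ≫ eHomWhiskerRight SSet.{v} f Z := by
  rw [pairing, pairing, Category.assoc, eComp_eHomWhiskerRight, MonoidalCategory.tensorHom_def',
    MonoidalCategory.tensorHom_def', comp_whiskerRight]
  simp only [Category.assoc]

lemma pairing_exchange (h : K ⟶ (X ⟶[SSet.{v}] Y)) (g : Y ⟶ Y') (e : L ⟶ (Y' ⟶[SSet.{v}] Z)) :
    pairing (h ≫ eHomWhiskerLeft SSet.{v} X g) e =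
      pairing h (e ≫ eHomWhiskerRight SSet.{v} g Z) := by
  have h₁ := comp_pairing h (eHomWhiskerLeft SSet.{v} X g) e
  have h₂ := pairing_comp h e (eHomWhiskerRight SSet.{v} g Z)
  have h₃ := pairing_comp (eHomWhiskerLeft SSet.{v} X g) e (𝟙 _)
  have h₄ := comp_pairing h (𝟙 _) (eHomWhiskerRight SSet.{v} g Z)
  rw [Category.comp_id] at h₃
  rw [Category.comp_id] at h₄
  rw [h₁, h₃, h₂, h₄, whisker_exchange_assoc]
  simp only [pairing, tensorHom_id, id_tensorHom, eHomWhiskerLeft_whiskerRight_eComp]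

lemma pairing_eHomEquiv (f : X ⟶ Y) (e : L ⟶ (Y ⟶[SSet.{v}] Z)) :
    pairing (eHomEquiv SSet.{v} f) e = (λ_ L).hom ≫ e ≫ eHomWhiskerRight SSet.{v} f Z := by
  rw [pairing, eHomWhiskerRight, leftUnitor_inv_naturality_assoc, Iso.hom_inv_id_assoc,
    MonoidalCategory.tensorHom_def'_assoc]

lemma pairing_constHom (f : X ⟶ Y) (e : L ⟶ (Y ⟶[SSet.{v}] Z)) :
    pairing (constHom K f) e =
      SemiCartesianMonoidalCategory.snd K L ≫ e ≫ eHomWhiskerRight SSet.{v} f Z := by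
  rw [constHom, comp_pairing, pairing_eHomEquiv, ← Category.assoc]
  rfl

end Pairing

/-! ### `U` preserves totalizations -/

section TotRightAdjoint

variable {M : Type u₁} [Category.{v} M] [SimplicialCategory M] [HasCotensors M] [HasLimits M]
variable {N : Type u₂} [Category.{v} N] [SimplicialCategory N]
variable {U : EnrichedFunctor SSet.{v} M N} {L : EnrichedFunctor SSet.{v} N M}

variable (U) in
/-- The universal map `Δ[n] ⟶ Map(U (tot Z), U (Z n))`. -/
def totEvMap (Z : CosimplicialObject M) (n : SimplexCategory) :
    SSet.stdSimplex.{v}.obj n ⟶ (U.obj (tot Z) ⟶[SSet.{v}] U.obj (Z.obj n)) :=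
  totEv Z n ≫ U.map _ _

lemma totEvMap_naturality (Z : CosimplicialObject M) {m n : SimplexCategory} (θ : m ⟶ n) :
    SSet.stdSimplex.map θ ≫ totEvMap U Z n =
      totEvMap U Z m ≫ eHomWhiskerLeft SSet.{v} _ (umap U (Z.map θ)) := by
  rw [totEvMap, totEv_naturality_assoc, eHomWhiskerLeft_enrichedMap, totEvMap, Category.assoc]

lemma totEvMap_totMap {Z W : CosimplicialObject M} (φ : Z ⟶ W) (n : SimplexCategory) :
    totEvMap U W n ≫ eHomWhiskerRight SSet.{v} (umap U (totMap φ)) _ =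
      totEvMap U Z n ≫ eHomWhiskerLeft SSet.{v} _ (umap U (φ.app n)) := by
  rw [totEvMap, Category.assoc, ← eHomWhiskerRight_enrichedMap, totEv_totMap_assoc,
    eHomWhiskerLeft_enrichedMap, totEvMap, Category.assoc]

variable (adjLU : SimplicialAdjunction L U)

lemma totEv_whiskerRight_transpose {Z : CosimplicialObject M} {Q : N} (g : Q ⟶ U.obj (tot Z))
    (n : SimplexCategory) :
    totEv Z n ≫ eHomWhiskerRight SSet.{v} (umap L g ≫ adjLU.ε (tot Z)) _ =
      (totEvMap U Z n ≫ eHomWhiskerRight SSet.{v} g _) ≫ adjLU.toLeft Q (Z.obj n) := by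
  have h : eHomWhiskerRight SSet.{v} (adjLU.ε (tot Z)) (Z.obj n) =
      U.map (tot Z) (Z.obj n) ≫ adjLU.toLeft (U.obj (tot Z)) (Z.obj n) :=
    adjLU.counit_naturality (tot Z) (Z.obj n)
  rw [eHomWhiskerRight_comp, h, Category.assoc, adjLU.toLeft_whiskerRight, totEvMap]
  simp only [Category.assoc]

-- Transposing along `L ⊣ U` reduces this uniqueness, and the existence in `exists_umap_totLift`, to
-- the universal property of `tot Z` in `M`.
include adjLU in
lemma umap_tot_hom_ext {Z : CosimplicialObject M} {Q : N} {f g : Q ⟶ U.obj (tot Z)}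
    (h : ∀ n, totEvMap U Z n ≫ eHomWhiskerRight SSet.{v} f _ =
      totEvMap U Z n ≫ eHomWhiskerRight SSet.{v} g _) : f = g := by
  have e : umap L f ≫ adjLU.ε (tot Z) = umap L g ≫ adjLU.ε (tot Z) :=
    tot_hom_ext fun n => by
      rw [totEv_whiskerRight_transpose, totEv_whiskerRight_transpose, h]
  have key (f : Q ⟶ U.obj (tot Z)) : f = adjLU.η Q ≫ umap U (umap L f ≫ adjLU.ε (tot Z)) := by
    rw [umap_comp, ← adjLU.η_naturality_assoc, adjLU.right_triangle, Category.comp_id]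
  rw [key f, e, ← key g]

include adjLU in
lemma exists_umap_totLift (Z : CosimplicialObject M) {Q : N}
    (e : ∀ n : SimplexCategory, SSet.stdSimplex.{v}.obj n ⟶ (Q ⟶[SSet.{v}] U.obj (Z.obj n)))
    (he : ∀ ⦃m n : SimplexCategory⦄ (θ : m ⟶ n), SSet.stdSimplex.map θ ≫ e n =
      e m ≫ eHomWhiskerLeft SSet.{v} Q (umap U (Z.map θ))) :
    ∃ g : Q ⟶ U.obj (tot Z), ∀ n, totEvMap U Z n ≫ eHomWhiskerRight SSet.{v} g _ = e n := by
  obtain ⟨g, hg⟩ := exists_totLift Z (A := L.obj Q) (fun n => e n ≫ adjLU.toLeft Q (Z.obj n))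
    (fun m n θ => by
      rw [← Category.assoc, he, Category.assoc, Category.assoc, adjLU.toLeft_whiskerLeft])
  refine ⟨adjLU.η Q ≫ umap U g, fun n => ?_⟩
  rw [← cancel_mono (adjLU.toLeft Q (Z.obj n)), ← hg, ← totEv_whiskerRight_transpose, umap_comp,
    Category.assoc, adjLU.ε_naturality, adjLU.left_triangle_assoc]

variable [HasTensors N]

-- Maps from `K` to `Map(B, -)` are maps out of `K ⊗ B`, so the unenriched statement applies to `K ⊗
-- B`; its components are compared by the universal property of the tensor, tested on `Δ[n]`.
include adjLU in
lemma sHom_umap_tot_ext {Z : CosimplicialObject M} {K : SSet.{v}} {B : N}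
    {h h' : K ⟶ (B ⟶[SSet.{v}] U.obj (tot Z))}
    (w : ∀ n, pairing h (totEvMap U Z n) = pairing h' (totEvMap U Z n)) : h = h' := by
  apply tensorDesc_injective
  apply umap_tot_hom_ext adjLU
  intro n
  apply ((theTensor K B).bijective (U.obj (Z.obj n)) (SSet.stdSimplex.obj n)).1
  change pairing (tensorCoev K B) _ = pairing (tensorCoev K B) _
  rw [← pairing_exchange, ← pairing_exchange, tensorDesc_fac, tensorDesc_fac, w]

include adjLU in
lemma exists_sHom_umap_tot (Z : CosimplicialObject M) {K : SSet.{v}} {B : N}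
    (e : ∀ n : SimplexCategory, K ⊗ SSet.stdSimplex.{v}.obj n ⟶ (B ⟶[SSet.{v}] U.obj (Z.obj n)))
    (he : ∀ ⦃m n : SimplexCategory⦄ (θ : m ⟶ n), (K ◁ SSet.stdSimplex.map θ) ≫ e n =
      e m ≫ eHomWhiskerLeft SSet.{v} B (umap U (Z.map θ))) :
    ∃ h : K ⟶ (B ⟶[SSet.{v}] U.obj (tot Z)), ∀ n, pairing h (totEvMap U Z n) = e n := by
  have hb (n : SimplexCategory) :=
    (theTensor K B).bijective (U.obj (Z.obj n)) (SSet.stdSimplex.obj n)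
  choose e' he' using fun n => (hb n).2 (e n)
  replace he' (n : SimplexCategory) : pairing (tensorCoev K B) (e' n) = e n := he' n
  obtain ⟨g, hg⟩ := exists_umap_totLift adjLU Z (Q := tensor K B) e' (fun m n θ => by
    apply ((theTensor K B).bijective (U.obj (Z.obj n)) (SSet.stdSimplex.obj m)).1
    change pairing (tensorCoev K B) _ = pairing (tensorCoev K B) _
    refine (pairing_comp _ _ _).trans (Eq.trans ?_ (pairing_whiskerLeft _ _ _).symm)
    rw [he', he', he])
  refine ⟨tensorCoev K B ≫ eHomWhiskerLeft SSet.{v} B g, fun n => ?_⟩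
  rw [pairing_exchange, hg, he']

end TotRightAdjoint

/-! ### Extra codegeneracies and the contracting homotopy -/

section Contraction

variable {M : Type u₁} [Category.{v} M] [SimplicialCategory M]
variable {N : Type u₂} [Category.{v} N] [SimplicialCategory N]

/-- A coaugmentation `X ⟶ Z` of a cosimplicial object together with extra codegeneracies of
the coaugmented cosimplicial object `U X ⟶ U Z`. -/
structure Contraction (U : EnrichedFunctor SSet.{v} M N) (Z : CosimplicialObject M) (X : M) where
  /-- the coaugmentation -/
  coaug (n : SimplexCategory) : X ⟶ Z.obj n
  /-- the extra codegeneracies -/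
  extra (n : SimplexCategory) : U.obj (Z.obj ⦋n.len + 1⦌) ⟶ U.obj (Z.obj n)
  /-- the retraction of the coaugmentation -/
  extraZero : U.obj (Z.obj ⦋0⦌) ⟶ U.obj X
  -- The shifted map is the join of `⦋0⦌` with `θ`, as in `cone_naturality`.
  naturality {m n : SimplexCategory} (θ : m ⟶ n) :
    umap U (Z.map (MonoCode.hom (m := ⦋m.len + 1⦌) (n := ⦋n.len + 1⦌)
      (MonoCode.ofOrderHom θ.toOrderHom).skip.hit)) ≫ extra n = extra m ≫ umap U (Z.map θ)
  -- `face` and `vertex` compute the two ends of the contracting homotopy, and `coaug_extra` makes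
  -- it constant on `X`.
  face (n : SimplexCategory) :
    umap U (Z.map (MonoCode.hom (m := n) (n := ⦋n.len + 1⦌)
      (MonoCode.idCode (n.len + 1)).skip)) ≫ extra n = 𝟙 _
  vertex (n : SimplexCategory) :
    umap U (Z.map (MonoCode.hom (m := ⦋0⦌) (n := ⦋n.len + 1⦌)
      (MonoCode.emptyCode (n.len + 1)).skip.hit)) ≫ extra n = extraZero ≫ umap U (coaug n)
  coaug_extra (n : SimplexCategory) :
    umap U (coaug ⦋n.len + 1⦌) ≫ extra n = umap U (coaug n)
  coaug_extraZero : umap U (coaug ⦋0⦌) ≫ extraZero = 𝟙 _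

lemma constHom_injective {C : Type u} [Category.{v} C] [SimplicialCategory C] {X Y : C}
    {f g : X ⟶ Y} (h : constHom (Δ[0] : SSet.{v}) f = constHom Δ[0] g) : f = g := by
  apply (eHomEquiv SSet.{v}).injective
  have := (SSet.const (SSet.stdSimplex.obj₀Equiv.symm 0) : 𝟙_ SSet.{v} ⟶ Δ[0]) ≫= h
  rwa [comp_constHom, comp_constHom, constHom_unit, constHom_unit] at this

variable [HasCotensors M] [HasLimits M]
variable {U : EnrichedFunctor SSet.{v} M N} {L : EnrichedFunctor SSet.{v} N M}
  (adjLU : SimplicialAdjunction L U)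

variable (U) in
/-- The map `U (tot Z) ⟶ U (Z 0)` given by the vertex of `Δ[0]`. -/
def totVertex (Z : CosimplicialObject M) : U.obj (tot Z) ⟶ U.obj (Z.obj ⦋0⦌) :=
  (eHomEquiv SSet.{v}).symm
    ((SSet.const (SSet.stdSimplex.obj₀Equiv.symm 0) : 𝟙_ SSet.{v} ⟶ Δ[0]) ≫ totEvMap U Z ⦋0⦌)

lemma constHom_totVertex (Z : CosimplicialObject M) :
    constHom Δ[0] (totVertex U Z) = totEvMap U Z ⦋0⦌ := by
  rw [constHom, totVertex, Equiv.apply_symm_apply]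
  refine (Category.assoc _ _ _).symm.trans ?_
  exact (congrArg (· ≫ totEvMap U Z ⦋0⦌)
    (SSet.stdSimplex.isTerminalObj₀.hom_ext _ (𝟙 _))).trans (Category.id_comp _)

namespace Contraction

variable {Z : CosimplicialObject M} {X : M} (c : Contraction U Z X) {ν : X ⟶ tot Z}
  (hν : ∀ n, totEv Z n ≫ eHomWhiskerRight SSet.{v} ν _ = constHom _ (c.coaug n))

include hν in
lemma totEvMap_ν (n : SimplexCategory) :
    totEvMap U Z n ≫ eHomWhiskerRight SSet.{v} (umap U ν) _ =
      constHom _ (umap U (c.coaug n)) := by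
  rw [totEvMap, Category.assoc, ← eHomWhiskerRight_enrichedMap, ← Category.assoc, hν,
    constHom_enrichedMap]

/-- The retraction of `U X ⟶ U (tot Z)`. -/
def retraction : U.obj (tot Z) ⟶ U.obj X := totVertex U Z ≫ c.extraZero

include hν in
lemma ν_retraction : umap U ν ≫ c.retraction = 𝟙 _ := by
  have h : umap U ν ≫ totVertex U Z = umap U (c.coaug ⦋0⦌) := by
    apply constHom_injective
    rw [← constHom_whiskerRight, constHom_totVertex]
    exact totEvMap_ν c hν ⦋0⦌
  rw [retraction, ← Category.assoc, h, c.coaug_extraZero]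

variable {W : CosimplicialObject M} {Y : M} (d : Contraction U W Y) (φ : Z ⟶ W)

lemma retraction_naturality (f : X ⟶ Y)
    (h : umap U (φ.app ⦋0⦌) ≫ d.extraZero = c.extraZero ≫ umap U f) :
    umap U (totMap φ) ≫ d.retraction = c.retraction ≫ umap U f := by
  have h' : umap U (totMap φ) ≫ totVertex U W = totVertex U Z ≫ umap U (φ.app ⦋0⦌) := by
    apply constHom_injective
    rw [← constHom_whiskerRight, constHom_totVertex, ← constHom_whiskerLeft, constHom_totVertex]
    exact totEvMap_totMap _ _
  rw [retraction, retraction, ← Category.assoc, h', Category.assoc, Category.assoc, h]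

variable [HasTensors N]

-- The cone raises the dimension by one and the extra codegeneracy lowers it again. Both are natural
-- with respect to the same joins, so the levelwise formula assembles to a map into the
-- totalization.
include adjLU in
lemma exists_homotopy :
    ∃ h : Δ[1] ⟶ (U.obj (tot Z) ⟶[SSet.{v}] U.obj (tot Z)),
      ∀ n, pairing h (totEvMap U Z n) =
        cone n ≫ totEvMap U Z ⦋n.len + 1⦌ ≫ eHomWhiskerLeft SSet.{v} _ (c.extra n) := by
  refine exists_sHom_umap_tot adjLU Z (fun n => cone n ≫ totEvMap U Z ⦋n.len + 1⦌ ≫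
    eHomWhiskerLeft SSet.{v} _ (c.extra n)) (fun m n θ => ?_)
  rw [← Category.assoc, cone_naturality, Category.assoc, ← Category.assoc (SSet.stdSimplex.map _),
    totEvMap_naturality, Category.assoc, Category.assoc, Category.assoc, ← eHomWhiskerLeft_comp,
    ← eHomWhiskerLeft_comp, c.naturality]

/-- The contracting homotopy of `U (tot Z)`. -/
def homotopy : Δ[1] ⟶ (U.obj (tot Z) ⟶[SSet.{v}] U.obj (tot Z)) :=
  (c.exists_homotopy adjLU).choose

lemma pairing_homotopy (n : SimplexCategory) :
    pairing (c.homotopy adjLU) (totEvMap U Z n) =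
      cone n ≫ totEvMap U Z ⦋n.len + 1⦌ ≫ eHomWhiskerLeft SSet.{v} _ (c.extra n) :=
  (c.exists_homotopy adjLU).choose_spec n

lemma vertexOne_homotopy : vertexOne ≫ c.homotopy adjLU = eHomEquiv SSet.{v} (𝟙 _) := by
  apply sHom_umap_tot_ext adjLU
  intro n
  rw [comp_pairing, pairing_eHomEquiv, eHomWhiskerRight_id, Category.comp_id, pairing_homotopy,
    ← Category.assoc, vertexOne_cone, Category.assoc, ← Category.assoc (SSet.stdSimplex.map _),
    totEvMap_naturality, Category.assoc, ← eHomWhiskerLeft_comp, c.face,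
    eHomWhiskerLeft_id, Category.comp_id]

include hν in
lemma horn_homotopy :
    (SSet.horn.{v} 1 0).ι ≫ c.homotopy adjLU = constHom _ (c.retraction ≫ umap U ν) := by
  apply sHom_umap_tot_ext adjLU
  intro n
  rw [comp_pairing, pairing_constHom, pairing_homotopy, eHomWhiskerRight_comp,
    ← Category.assoc (totEvMap _ _ _), totEvMap_ν c hν, constHom_whiskerRight, comp_constHom,
    ← Category.assoc, horn_cone, Category.assoc, ← Category.assoc (SSet.stdSimplex.map _),
    totEvMap_naturality, Category.assoc, ← eHomWhiskerLeft_comp, c.vertex,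
    ← constHom_totVertex, constHom_whiskerLeft, comp_constHom, retraction, Category.assoc]

include hν in
lemma homotopy_ν :
    c.homotopy adjLU ≫ eHomWhiskerRight SSet.{v} (umap U ν) _ = constHom _ (umap U ν) := by
  apply sHom_umap_tot_ext adjLU
  intro n
  rw [pairing_whiskerRight, pairing_constHom, totEvMap_ν c hν, comp_constHom, pairing_homotopy,
    Category.assoc, Category.assoc, eHom_whisker_exchange, ← Category.assoc (totEvMap _ _ _),
    totEvMap_ν c hν, constHom_whiskerLeft, comp_constHom, c.coaug_extra]

lemma homotopy_naturality
    (h : ∀ n, umap U (φ.app ⦋n.len + 1⦌) ≫ d.extra n = c.extra n ≫ umap U (φ.app n)) :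
    c.homotopy adjLU ≫ eHomWhiskerLeft SSet.{v} _ (umap U (totMap φ)) =
      d.homotopy adjLU ≫ eHomWhiskerRight SSet.{v} (umap U (totMap φ)) _ := by
  apply sHom_umap_tot_ext adjLU
  intro n
  rw [pairing_exchange, pairing_whiskerRight, totEvMap_totMap, pairing_whiskerLeft,
    pairing_homotopy, pairing_homotopy, Category.assoc, Category.assoc, Category.assoc,
    Category.assoc, eHom_whisker_exchange, ← eHomWhiskerLeft_comp, ← h, eHomWhiskerLeft_comp,
    ← Category.assoc (totEvMap _ _ _), ← Category.assoc (totEvMap _ _ _), totEvMap_totMap]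

end Contraction

end Contraction

/-! ### The extra codegeneracies of the cobar construction -/

section CobarContraction

variable {M : Type u₁} [Category.{v} M] [SimplicialCategory M]
variable {N : Type u₂} [Category.{v} N] [SimplicialCategory N]
variable {U : EnrichedFunctor SSet.{v} M N} {R : EnrichedFunctor SSet.{v} N M}
  (adjUR : SimplicialAdjunction U R)

/-- The cosimplicial object `[n] ↦ (R U)ⁿ⁺¹ X`. -/
abbrev cobarObj (X : M) : CosimplicialObject M := (cobarCosimplicial adjUR.adj.toMonad).obj X

/-- The extra codegeneracy `U (R U)ⁿ⁺² X ⟶ U (R U)ⁿ⁺¹ X`. -/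
def extraDegeneracy (X : M) (n : SimplexCategory) :
    U.obj ((cobarObj adjUR X).obj ⦋n.len + 1⦌) ⟶ U.obj ((cobarObj adjUR X).obj n) :=
  adjUR.ε (U.obj ((cobarObj adjUR X).obj n))

/-- The extra codegeneracy `U R U X ⟶ U X`. -/
def extraDegeneracyZero (X : M) : U.obj ((cobarObj adjUR X).obj ⦋0⦌) ⟶ U.obj X :=
  adjUR.ε (U.obj X)

/-- The coaugmentation `X ⟶ (R U)ⁿ⁺¹ X`. -/
def cobarCoaug (X : M) (n : SimplexCategory) : X ⟶ (cobarObj adjUR X).obj n :=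
  (coaugmentation adjUR.adj.toMonad n).app X

lemma cobarObj_map_hom (X : M) {m n : SimplexCategory}
    (c : MonoCode (m.len + 1) (n.len + 1)) :
    (cobarObj adjUR X).map c.hom = (act adjUR.adj.toMonad c).app X :=
  congrArg (fun α => α.app X) (resolution_map_hom adjUR.adj.toMonad c)

/-- The unit of the monad is that of `U ⊣ R`, so a triangle identity applies. -/
lemma umap_unit_ε (X : M) {Y : M} (g : Y ⟶ X) :
    umap U (g ≫ adjUR.adj.toMonad.η.app X) ≫ adjUR.ε (U.obj X) = umap U g := by
  refine (congrArg (· ≫ adjUR.ε (U.obj X)) (umap_comp U g _)).trans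
    ((Category.assoc _ _ _).trans ?_)
  exact (congrArg (umap U g ≫ ·) (adjUR.left_triangle X)).trans (Category.comp_id _)

lemma extraDegeneracy_naturality (X : M) {m n : SimplexCategory} (θ : m ⟶ n) :
    umap U ((cobarObj adjUR X).map (MonoCode.hom (m := ⦋m.len + 1⦌) (n := ⦋n.len + 1⦌)
      (MonoCode.ofOrderHom θ.toOrderHom).skip.hit)) ≫ extraDegeneracy adjUR X n =
    extraDegeneracy adjUR X m ≫ umap U ((cobarObj adjUR X).map θ) := by
  rw [cobarObj_map_hom]
  refine (congrArg (fun g => umap U g ≫ extraDegeneracy adjUR X n)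
    (act_hit_skip_app adjUR.adj.toMonad (MonoCode.ofOrderHom θ.toOrderHom) X)).trans ?_
  exact adjUR.ε_naturality (umap U ((cobarObj adjUR X).map θ))

lemma extraDegeneracy_face (X : M) (n : SimplexCategory) :
    umap U ((cobarObj adjUR X).map (MonoCode.hom (m := n) (n := ⦋n.len + 1⦌)
      (MonoCode.idCode (n.len + 1)).skip)) ≫ extraDegeneracy adjUR X n = 𝟙 _ := by
  rw [cobarObj_map_hom]
  refine (umap_unit_ε adjUR ((cobarObj adjUR X).obj n) _).trans ?_
  rw [act_idCode]
  exact umap_id U _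

lemma extraDegeneracy_vertex (X : M) (n : SimplexCategory) :
    umap U ((cobarObj adjUR X).map (MonoCode.hom (m := ⦋0⦌) (n := ⦋n.len + 1⦌)
      (MonoCode.emptyCode (n.len + 1)).skip.hit)) ≫ extraDegeneracy adjUR X n =
    extraDegeneracyZero adjUR X ≫ umap U (cobarCoaug adjUR X n) := by
  rw [cobarObj_map_hom]
  refine (congrArg (fun g => umap U g ≫ extraDegeneracy adjUR X n)
    (act_hit_skip_app adjUR.adj.toMonad (MonoCode.emptyCode (n.len + 1)) X)).trans ?_
  exact adjUR.ε_naturality (umap U (cobarCoaug adjUR X n))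

lemma cobarCoaug_extraDegeneracy (X : M) (n : SimplexCategory) :
    umap U (cobarCoaug adjUR X ⦋n.len + 1⦌) ≫ extraDegeneracy adjUR X n =
      umap U (cobarCoaug adjUR X n) :=
  umap_unit_ε adjUR ((cobarObj adjUR X).obj n) (cobarCoaug adjUR X n)

lemma cobarCoaug_extraDegeneracyZero (X : M) :
    umap U (cobarCoaug adjUR X ⦋0⦌) ≫ extraDegeneracyZero adjUR X = 𝟙 _ :=
  (umap_unit_ε adjUR X (𝟙 X)).trans (umap_id U X)

lemma extraDegeneracy_natural {X Y : M} (f : X ⟶ Y) (n : SimplexCategory) :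
    umap U (((cobarCosimplicial adjUR.adj.toMonad).map f).app ⦋n.len + 1⦌) ≫
        extraDegeneracy adjUR Y n =
      extraDegeneracy adjUR X n ≫
        umap U (((cobarCosimplicial adjUR.adj.toMonad).map f).app n) :=
  adjUR.ε_naturality (umap U (((cobarCosimplicial adjUR.adj.toMonad).map f).app n))

lemma extraDegeneracyZero_natural {X Y : M} (f : X ⟶ Y) :
    umap U (((cobarCosimplicial adjUR.adj.toMonad).map f).app ⦋0⦌) ≫
        extraDegeneracyZero adjUR Y = extraDegeneracyZero adjUR X ≫ umap U f :=
  adjUR.ε_naturality (umap U f)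

/-- The extra codegeneracies of `U X ⟶ U (R U)ⁿ⁺¹ X`. -/
def cobarContraction (X : M) : Contraction U (cobarObj adjUR X) X where
  coaug := cobarCoaug adjUR X
  extra := extraDegeneracy adjUR X
  extraZero := extraDegeneracyZero adjUR X
  naturality := extraDegeneracy_naturality adjUR X
  face := extraDegeneracy_face adjUR X
  vertex := extraDegeneracy_vertex adjUR X
  coaug_extra := cobarCoaug_extraDegeneracy adjUR X
  coaug_extraZero := cobarCoaug_extraDegeneracyZero adjUR X

end CobarContraction

/-! ### Preservation of pullbacks and terminal objects -/

section PreservesLimits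

variable {M : Type u₁} [Category.{v} M] [SimplicialCategory M]
variable {N : Type u₂} [Category.{v} N] [SimplicialCategory N]
variable {U : EnrichedFunctor SSet.{v} M N} {L R : EnrichedFunctor SSet.{v} N M}
  (adjLU : SimplicialAdjunction L U) (adjUR : SimplicialAdjunction U R)

include adjLU in
lemma isPullback_umap {P A B S : M} {fst : P ⟶ A} {snd : P ⟶ B} {f : A ⟶ S} {g : B ⟶ S}
    (h : IsPullback fst snd f g) :
    IsPullback (umap U fst) (umap U snd) (umap U f) (umap U g) := by
  have := adjLU.adj.rightAdjoint_preservesLimits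
  exact h.map (underlying U)

include adjLU in
lemma nonempty_isTerminal_umap {X : M} (hX : IsTerminal X) : Nonempty (IsTerminal (U.obj X)) := by
  have := adjLU.adj.rightAdjoint_preservesLimits
  exact ⟨hX.isTerminalObj (underlying U)⟩

include adjLU in
lemma nonempty_isTerminal_iterObj {X : M} (hX : IsTerminal X) (n : ℕ) :
    Nonempty (IsTerminal (iterObj adjUR n X)) := by
  induction n with
  | zero => exact ⟨hX⟩
  | succ n ih =>
    obtain ⟨h⟩ := nonempty_isTerminal_umap adjLU ih.some
    exact nonempty_isTerminal_umap adjUR h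

end PreservesLimits

/-! ### Left half of the factorization, and the characterization -/

section CobarFactorization

variable {M : Type u₁} [Category.{v} M] [SimplicialCategory M] [HasCotensors M] [HasLimits M]
variable {N : Type u₂} [Category.{v} N] [SimplicialCategory N] [ModelCategory N]
  [SimplicialModelCategory N]
variable {U : EnrichedFunctor SSet.{v} M N} {L R : EnrichedFunctor SSet.{v} N M}
  (adjLU : SimplicialAdjunction L U) (adjUR : SimplicialAdjunction U R)

include adjLU in
/-- The map from `X` to the pullback `Y ×_{tot W} tot Z` is a `U`-trivial cofibration if `X ⟶ Z` and
`Y ⟶ W` are contractible after applying `U`. -/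
lemma Contraction.trivialCofibrations_umap
    (hcof : cofibrations N = MorphismProperty.monomorphisms N)
    {Z W : CosimplicialObject M} {X Y E : M} (c : Contraction U Z X) (d : Contraction U W Y)
    {νX : X ⟶ tot Z} {νY : Y ⟶ tot W}
    (hνX : ∀ n, totEv Z n ≫ eHomWhiskerRight SSet.{v} νX _ = constHom _ (c.coaug n))
    (hνY : ∀ n, totEv W n ≫ eHomWhiskerRight SSet.{v} νY _ = constHom _ (d.coaug n))
    (φ : Z ⟶ W) (f : X ⟶ Y)
    (h₀ : umap U (φ.app ⦋0⦌) ≫ d.extraZero = c.extraZero ≫ umap U f)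
    (h : ∀ n, umap U (φ.app ⦋n.len + 1⦌) ≫ d.extra n = c.extra n ≫ umap U (φ.app n))
    {fst : E ⟶ tot Z} {snd : E ⟶ Y} (sq : IsPullback fst snd (totMap φ) νY)
    (l : X ⟶ E) (hl₁ : l ≫ fst = νX) (hl₂ : l ≫ snd = f) :
    trivialCofibrations N (umap U l) := by
  have sq' := isPullback_umap adjLU sq
  have w : umap U fst ≫ umap U (totMap φ) = umap U snd ≫ umap U νY := sq'.w
  have hl₁' : umap U l ≫ umap U fst = umap U νX := by rw [← umap_comp, hl₁]
  have hl₂' : umap U l ≫ umap U snd = umap U f := by rw [← umap_comp, hl₂]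
  let s : U.obj E ⟶ U.obj X := umap U fst ≫ c.retraction
  have hs : umap U l ≫ s = 𝟙 _ := by
    dsimp only [s]
    rw [← Category.assoc, hl₁', c.ν_retraction hνX]
  have hsf : s ≫ umap U f = umap U snd := by
    dsimp only [s]
    rw [Category.assoc, ← c.retraction_naturality d φ f h₀, ← Category.assoc, w, Category.assoc,
      d.ν_retraction hνY, Category.comp_id]
  -- The homotopy of `U E` is the contraction on the factor `U (tot Z)` and constant on the factor
  -- `U Y`. The two agree over `U (tot W)` since the contraction is natural and is constant along
  -- `νY`.
  obtain ⟨H, hH₁, hH₂⟩ := exists_sHom_pullback_lift sq'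
    (c.homotopy adjLU ≫ eHomWhiskerRight SSet.{v} (umap U fst) _) (constHom Δ[1] (umap U snd)) (by
      rw [Category.assoc, ← eHom_whisker_exchange, ← Category.assoc,
        c.homotopy_naturality adjLU d φ h, Category.assoc, ← eHomWhiskerRight_comp, w,
        eHomWhiskerRight_comp, ← Category.assoc, d.homotopy_ν adjLU hνY, constHom_whiskerRight,
        constHom_whiskerLeft])
  -- `U l` is split by `s`, hence a monomorphism; all monomorphisms of `N` are cofibrations.
  have hm : cofibrations N (umap U l) := by
    rw [hcof]
    exact (SplitMono.mk s hs).mono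
  refine trivialCofibrations_of_deformationRetract (umap U l) hm (SSet.horn.{v} 1 0).ι
    (SSet.anodyneExtensions.horn_ι 0) inferInstance vertexOne s hs H ?_ ?_ ?_
  · apply sHom_pullback_hom_ext sq'
    · rw [Category.assoc, hH₁, ← Category.assoc, c.horn_homotopy adjLU hνX,
        constHom_whiskerRight, constHom_whiskerLeft, Category.assoc, hl₁', Category.assoc]
    · rw [Category.assoc, hH₂, comp_constHom, constHom_whiskerLeft, Category.assoc, hl₂', hsf]
  · apply sHom_pullback_hom_ext sq'
    · rw [Category.assoc, hH₁, ← Category.assoc, c.vertexOne_homotopy adjLU,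
        eHomEquiv_whiskerRight, eHomEquiv_whiskerLeft, Category.comp_id, Category.id_comp]
    · rw [Category.assoc, hH₂, comp_constHom, constHom_unit, eHomEquiv_whiskerLeft,
        Category.id_comp]
  · apply sHom_pullback_hom_ext sq'
    · rw [Category.assoc, ← eHom_whisker_exchange, ← Category.assoc, hH₁, Category.assoc,
        ← eHomWhiskerRight_comp, hl₁', c.homotopy_ν adjLU hνX, constHom_whiskerLeft, hl₁']
    · rw [Category.assoc, ← eHom_whisker_exchange, ← Category.assoc, hH₂, constHom_whiskerRight,
        constHom_whiskerLeft]

include adjLU in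
/-- The left map of the cobar factorization is a `U`-trivial cofibration. -/
theorem UTrivialCofibrations_cobarLeft
    (hcof : cofibrations N = MorphismProperty.monomorphisms N) {X Y : M} (f : X ⟶ Y) :
    UTrivialCofibrations (underlying U) (cobarLeft adjUR.adj.toMonad f) :=
  Contraction.trivialCofibrations_umap adjLU hcof (cobarContraction adjUR X)
    (cobarContraction adjUR Y) (totEv_cobarUnit _ X) (totEv_cobarUnit _ Y)
    ((cobarCosimplicial adjUR.adj.toMonad).map f) f (extraDegeneracyZero_natural adjUR f)
    (extraDegeneracy_natural adjUR f) (IsPullback.of_hasPullback _ _) _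
    (pullback.lift_fst _ _ _) (pullback.lift_snd _ _ _)

/-- The injective fibrations are the `U`-fibrations whose cobar factorization splits. -/
theorem injectiveFibrations_iff
    (hcof : cofibrations N = MorphismProperty.monomorphisms N)
    (hunit : IsQuillenCofibration adjLU.adj.unit) {X Y : M} (f : X ⟶ Y) :
    injectiveFibrations (underlying U) f ↔ UFibrations (underlying U) f ∧
      ∃ r : cobarFactorization adjUR.adj.toMonad f ⟶ X,
        cobarLeft adjUR.adj.toMonad f ≫ r = 𝟙 X ∧ r ≫ f = cobarRight adjUR.adj.toMonad f := by
  constructor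
  · intro hf
    refine ⟨UFibrations_of_injectiveFibrations adjLU hunit f hf, ?_⟩
    have := hf _ (UTrivialCofibrations_cobarLeft adjLU adjUR hcof f)
    have sq : CommSq (𝟙 X) (cobarLeft adjUR.adj.toMonad f) f (cobarRight adjUR.adj.toMonad f) :=
      ⟨(Category.id_comp f).trans (cobarLeft_comp_cobarRight _ f).symm⟩
    exact ⟨sq.lift, sq.fac_left, sq.fac_right⟩
  · rintro ⟨hf, r, hr, hrf⟩
    exact injectiveFibrations_of_retraction adjLU adjUR hunit f hf r hr hrf

end CobarFactorization

/-! ### The case of a terminal target -/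

section Terminal

variable {M : Type u₁} [Category.{v} M] [SimplicialCategory M] [HasCotensors M] [HasLimits M]
variable {N : Type u₂} [Category.{v} N] [SimplicialCategory N] [HasTensors N]
variable {U : EnrichedFunctor SSet.{v} M N} {L R : EnrichedFunctor SSet.{v} N M}
  (adjLU : SimplicialAdjunction L U) (adjUR : SimplicialAdjunction U R)

include adjLU in
/-- The cobar construction preserves terminal objects. -/
lemma cobar_hom_ext_of_isTerminal {X A : M} (hX : IsTerminal X)
    (f g : A ⟶ cobar adjUR.adj.toMonad X) : f = g :=
  tot_hom_ext fun n =>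
    sHom_ext_of_isTerminal adjUR
      (nonempty_isTerminal_umap adjLU (nonempty_isTerminal_iterObj adjLU adjUR hX n.len).some).some
      _ _

include adjLU in
/-- Over a terminal object, splitting the cobar factorization amounts to splitting
the coaugmentation of the cobar construction. -/
lemma exists_retraction_terminal_iff (X : M) :
    (∃ r : cobarFactorization adjUR.adj.toMonad (terminal.from X) ⟶ X,
        cobarLeft adjUR.adj.toMonad (terminal.from X) ≫ r = 𝟙 X ∧
          r ≫ terminal.from X = cobarRight adjUR.adj.toMonad (terminal.from X)) ↔
      ∃ r : cobar adjUR.adj.toMonad X ⟶ X, cobarUnit adjUR.adj.toMonad X ≫ r = 𝟙 X := by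
  let T := adjUR.adj.toMonad
  constructor
  · rintro ⟨r, hr, -⟩
    -- Any two maps into the cobar construction of a terminal object agree, so the pullback
    -- condition is void.
    let e : cobar T X ⟶ cobarFactorization T (terminal.from X) :=
      pullback.lift (𝟙 _) (terminal.from _)
        (cobar_hom_ext_of_isTerminal adjLU adjUR terminalIsTerminal _ _)
    have he : cobarUnit T X ≫ e = cobarLeft T (terminal.from X) := by
      apply pullback.hom_ext
      · exact (Category.assoc _ _ _).trans ((congrArg (cobarUnit T X ≫ ·)
          (pullback.lift_fst _ _ _)).trans ((Category.comp_id _).trans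
            (pullback.lift_fst _ _ _).symm))
      · exact Subsingleton.elim _ _
    exact ⟨e ≫ r, (Category.assoc _ _ _).symm.trans ((congrArg (· ≫ r) he).trans hr)⟩
  · rintro ⟨r, hr⟩
    refine ⟨pullback.fst _ _ ≫ r, ?_, Subsingleton.elim _ _⟩
    refine (Category.assoc _ _ _).symm.trans (Eq.trans ?_ hr)
    exact congrArg (· ≫ r) (pullback.lift_fst _ _ _)

end Terminal

end InjFib

end

/-! ### Injective fibrations and injectively fibrant objects -/

theorem mainTheorem6
    {M : Type u₁} [Category.{v} M] [SimplicialCategory M]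
    [Enriched.HasConicalLimits SSet.{v} M] [InjFib.HasCotensors M]
    {N : Type u₂} [Category.{v} N] [SimplicialCategory N]
    [ModelCategory N] [InjFib.SimplicialModelCategory N]
    (hcof : cofibrations N = MorphismProperty.monomorphisms N)
    (U : EnrichedFunctor SSet.{v} M N) (L R : EnrichedFunctor SSet.{v} N M)
    (adjLU : InjFib.SimplicialAdjunction L U) (adjUR : InjFib.SimplicialAdjunction U R)
    (hunit : InjFib.IsQuillenCofibration adjLU.adj.unit) :
    (∀ ⦃X Y : M⦄ (f : X ⟶ Y),
      InjFib.injectiveFibrations (InjFib.underlying U) f ↔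
        InjFib.UFibrations (InjFib.underlying U) f ∧
          ∃ r : InjFib.cobarFactorization adjUR.adj.toMonad f ⟶ X,
            InjFib.cobarLeft adjUR.adj.toMonad f ≫ r = 𝟙 X ∧
              r ≫ f = InjFib.cobarRight adjUR.adj.toMonad f) ∧
    (∀ X : M,
      InjFib.injectiveFibrations (InjFib.underlying U) (terminal.from X) ↔
        InjFib.UFibrations (InjFib.underlying U) (terminal.from X) ∧
          ∃ r : InjFib.cobar adjUR.adj.toMonad X ⟶ X,
            InjFib.cobarUnit adjUR.adj.toMonad X ≫ r = 𝟙 X) := by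
  refine ⟨fun X Y f => InjFib.injectiveFibrations_iff adjLU adjUR hcof hunit f, fun X => ?_⟩
  rw [InjFib.injectiveFibrations_iff adjLU adjUR hcof hunit,
    InjFib.exists_retraction_terminal_iff adjLU adjUR]
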